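/- **Setting.** Let $f:\mathbb R^n\to\mathbb R$ be differentiable with $f(z)\to\infty$ and $\|\nabla f(z)\|\to\infty$ as $\|z\|\to\infty$. Let $A_{eq}(z)\in\mathbb R^{m\times n}$, $A_{ineq}(z)\in\mathbb R^{p\times n}$ be matrix functions, $d_{eq}\in\mathbb R^m$, $d_{ineq}\in\mathbb R^p$, and $g_{eq}=A_{eq}\nabla f+d_{eq}$, $g_{ineq}=A_{ineq}\nabla f+d_{ineq}$, $\mathcal G_{ineq}=\{z: g_{ineq}(z)\le 0\}$. Put $\mathcal I(z)=\{i: g_{ineq,i}(z)=0\}$ and $\mathcal S=\{s\subseteq\{1,\dots,p\}: \exists z\in\mathbb R^n,\ s\subseteq\mathcal I(z)\}$. For $\mathcal A\in\mathcal S$ let $g_{\mathcal A},A_{\mathcal A},d_{\mathcal A}$ consist of all rows of $g_{eq},A_{eq},d_{eq}$ followed by the rows of $g_{ineq},A_{ineq},d_{ineq}$ with index in $\mathcal A$, and let $B_{\mathcal A}(z)=\frac{\partial g_{\mathcal A}}{\partial z}(z)A_{\mathcal A}^\top(z)$. Let $G_{\mathcal A}^\perp(z)\in\mathbb R^{(n-m-|\mathcal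 A|)\times n}$ have full row rank and satisfy $G_{\mathcal A}^\perp\frac{\partial g_{\mathcal A}}{\partial z}^\top=0$ on $\mathcal G_{ineq}$. Assume that $\nabla f$, $A_{eq}$, $A_{ineq}$, $G^\perp_{\mathcal A}$ are locally Lipschitz, and that $g_{eq},g_{ineq}$ are differentiable with locally Lipschitz Jacobians. Assume that for every $\mathcal A\in\mathcal S$ there are constants $\beta^1_{\mathcal A},\beta^2_{\mathcal A}>0$ such that for all $z\in\mathcal G_{ineq}$ the matrix $B_{\mathcal A}(z)$ is invertible and $$\tfrac12[B_{\mathcal A}(z)+B_{\mathcal A}^\top(z)]\ \ge\ \tfrac12\beta^1_{\mathcal A}B_{\mathcal A}(z)B_{\mathcal A}^\top(z)\ \ge\ \beta^2_{\mathcal A}I .$$ With $\kappa_1,\kappa_2,\delta T>0$, let $$h_{\mathcal A}(z)=-\big[\kappa_1A_{\mathcal A}^\top B_{\mathcal A}^{-1}A_{\mathcal A}+\kappa_2G_{\mathcal A}^{\perp\top}G_{\mathcal A}^{\perp}\big]\nabla f(z)-\kappa_1A_{\mathcal A}^\top B_{\mathcal A}^{-1}d_{\mathcal A}.$$ **Switched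 system.** A solution on $[0,L)$, $L\le\infty$, consists of $z$ with $z(t)=z(0)+\int_0^th_{\sigma(\tau)}(z(\tau))\,d\tau$ (integrand integrable), an active set $\sigma$ and a time of last removal $T_s$, where $(\sigma,T_s)$ is piecewise constant and left-continuous, $\sigma(0)=\mathcal I(z(0))$, $T_s(0)$ is given, and the right limits $(\sigma(t^+),T_s(t^+))$ are obtained as follows. First all $i\in\mathcal I(z(t))\setminus\sigma(t)$ with $\frac{\partial g_{ineq,i}}{\partial z}(z(t))h_{\sigma(t)}(z(t))\ge0$ are added to $\sigma$. Then the conditions of the law are tested immediately after $t$: if $(\sigma,T_s)$ is the current mode and $y$ is the solution of $\dot y=h_\sigma(y)$, $y(t)=z(t)$, then (a) all $i\in\mathcal I(z(t))\setminus\sigma$ with $\frac{\partial g_{ineq,i}}{\partial z}(y(s))h_{\sigma}(y(s))\ge0$ for times $s>t$ arbitrarily close to $t$ are added to $\sigma$; (b) if there are none, then the smallest $i\in\sigma$ for which $\frac{\partial g_{ineq,i}}{\partial z}(y(s))h_{\sigma\setminus\{i\}}(y(s))<0$ and $s>T_s+\delta T$ for times $s>t$ arbitrarily close to $t$ is removed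 from $\sigma$ and $T_s$ is set to $t$. This is repeated until neither (a) nor (b) applies. A set $W\subseteq\mathbb R^n$ is called positively invariant if every solution with $z(0)\in\mathcal G_{ineq}$, on any interval $[0,L)$, that satisfies $z(s)\in W$ also satisfies $z(t)\in W$ for all $t\ge s$ in $[0,L)$. **Claim.** 1. Let $\phi_{\mathcal A}>0$, $\mathcal A\in\mathcal S$, be constants with $A_{\mathcal A}^\top A_{\mathcal A}+G_{\mathcal A}^{\perp\top}G_{\mathcal A}^{\perp}>\phi_{\mathcal A}I$ on $\mathcal G_{ineq}$; let $\underline\phi,\underline{\beta_1},\underline{\beta_2}$ be the minima over $\mathcal A\in\mathcal S$ of $\phi_{\mathcal A},\beta^1_{\mathcal A},\beta^2_{\mathcal A}$. Every sublevel set $\{f\le c\}$ that contains $$\mathcal F=\Big\{z\in\mathbb R^n:\ \|\nabla f(z)\|^2\le\frac{\kappa_1}{\underline{\beta_2}\,\underline\phi\,\min\{\frac12\kappa_1\underline{\beta_1},\kappa_2\}}\Big\|\begin{bmatrix}d_{eq}\\ d_{ineq}\end{bmatrix}\Big\|^2\Big\}$$ is positively invariant. 2. For every $z_0\in\mathcal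 G_{ineq}$ there is a smallest sublevel set $\mathcal F0$ of $f$ that contains $\mathcal F$ and $z_0$, and it is positively invariant. 3. For every $z_0\in\mathcal G_{ineq}$ and every initial value $T_s(0)\in\mathbb R$ there is a solution $(z,\sigma,T_s)$ on $[0,\infty)$ with $z(0)=z_0$; $\sigma$ takes values in $\mathcal S$, $z$ is bounded, and $z$ is absolutely continuous on every interval $[0,t]$. It is unique: every solution on an interval $[0,L)$ with the same $z(0)$ and $T_s(0)$ coincides with it on $[0,L)$. (The constants $\phi_{\mathcal A}$ play no role in this part.) -/

import Mathlib

open Filter Topology Set MeasureTheory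
open scoped Matrix

noncomputable section

/-- Data of the optimisation problem `min f(z)` subject to `Aeq(z) ∇f(z) + deq = 0` and
`Aineq(z) ∇f(z) + dineq ≤ 0`, together with the design parameters of the optimisation dynamics:
the gains `κ₁, κ₂`, the dwell time `δT`, and for each set `A` of inequality indices a matrix
function `G A` with `n - m - |A|` rows (the left annihilator). -/
structure OptData (n m p : ℕ) where
  f : EuclideanSpace ℝ (Fin n) → ℝ
  Aeq : EuclideanSpace ℝ (Fin n) → Matrix (Fin m) (Fin n) ℝ
  Aineq : EuclideanSpace ℝ (Fin n) → Matrix (Fin p) (Fin n) ℝ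
  deq : Fin m → ℝ
  dineq : Fin p → ℝ
  κ₁ : ℝ
  κ₂ : ℝ
  δT : ℝ
  G : (A : Finset (Fin p)) → EuclideanSpace ℝ (Fin n) →
    Matrix (Fin (n - m - A.card)) (Fin n) ℝ

namespace OptData

variable {n m p : ℕ} (D : OptData n m p)

/-- The gradient of `f` as a coordinate vector. -/
def grad (z : EuclideanSpace ℝ (Fin n)) : Fin n → ℝ := (gradient D.f z).ofLp

/-- Equality constraint function. -/
def geq (z : EuclideanSpace ℝ (Fin n)) : Fin m → ℝ := D.Aeq z *ᵥ D.grad z + D.deq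

/-- Inequality constraint function. -/
def gineq (z : EuclideanSpace ℝ (Fin n)) : Fin p → ℝ := D.Aineq z *ᵥ D.grad z + D.dineq

/-- Jacobian matrix of `geq`. -/
def Jeq (z : EuclideanSpace ℝ (Fin n)) : Matrix (Fin m) (Fin n) ℝ :=
  Matrix.of fun i j => fderiv ℝ (fun w => D.geq w i) z (EuclideanSpace.single j 1)

/-- Jacobian matrix of `gineq`. -/
def Jineq (z : EuclideanSpace ℝ (Fin n)) : Matrix (Fin p) (Fin n) ℝ :=
  Matrix.of fun i j => fderiv ℝ (fun w => D.gineq w i) z (EuclideanSpace.single j 1)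

/-- The set on which the inequality constraints hold. -/
def Gineq : Set (EuclideanSpace ℝ (Fin n)) := {z | ∀ i, D.gineq z i ≤ 0}

open Classical in
/-- `I(z)`: the inequality constraints that hold with equality at `z`. -/
def act (z : EuclideanSpace ℝ (Fin n)) : Finset (Fin p) :=
  Finset.univ.filter fun i => D.gineq z i = 0

open Classical in
/-- The index set `S` of all sets of inequality constraints that can simultaneously hold with
equality. -/
def S : Finset (Finset (Fin p)) :=
  Finset.univ.filter fun s => ∃ z, s ⊆ D.act z

theorem S_nonempty : D.S.Nonempty :=
  ⟨∅, by simp [S]⟩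

/-- `A_A(z)`: the rows of `Aeq(z)` followed by the rows of `Aineq(z)` with index in `A`. -/
def AA (A : Finset (Fin p)) (z : EuclideanSpace ℝ (Fin n)) :
    Matrix (Fin m ⊕ {i // i ∈ A}) (Fin n) ℝ :=
  Matrix.fromRows (D.Aeq z) ((D.Aineq z).submatrix Subtype.val id)

/-- `d_A`: the entries of `deq` followed by the entries of `dineq` with index in `A`. -/
def dA (A : Finset (Fin p)) : Fin m ⊕ {i // i ∈ A} → ℝ :=
  Sum.elim D.deq fun i => D.dineq i.1

/-- Jacobian of the active constraint vector. -/
def JA (A : Finset (Fin p)) (z : EuclideanSpace ℝ (Fin n)) :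
    Matrix (Fin m ⊕ {i // i ∈ A}) (Fin n) ℝ :=
  Matrix.fromRows (D.Jeq z) ((D.Jineq z).submatrix Subtype.val id)

/-- `B_A(z) = (∂g_A/∂z)(z) A_A(z)ᵀ`. -/
def B (A : Finset (Fin p)) (z : EuclideanSpace ℝ (Fin n)) :
    Matrix (Fin m ⊕ {i // i ∈ A}) (Fin m ⊕ {i // i ∈ A}) ℝ :=
  D.JA A z * (D.AA A z)ᵀ

/-- The subsystem vector field
`h_A = -[κ₁ A_Aᵀ B_A⁻¹ A_A + κ₂ G_Aᵀ G_A] ∇f - κ₁ A_Aᵀ B_A⁻¹ d_A`. -/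
def h (A : Finset (Fin p)) (z : EuclideanSpace ℝ (Fin n)) : EuclideanSpace ℝ (Fin n) :=
  WithLp.toLp 2
    (-((D.κ₁ • ((D.AA A z)ᵀ * (D.B A z)⁻¹ * D.AA A z) + D.κ₂ • ((D.G A z)ᵀ * D.G A z))
        *ᵥ D.grad z)
      - D.κ₁ • (((D.AA A z)ᵀ * (D.B A z)⁻¹) *ᵥ D.dA A))

/-- Standing hypotheses on the data: positive parameters, `f` and `‖∇f‖` radially unbounded, the
regularity under which the subsystems are locally Lipschitz where `B_A` is invertible, and `G_A`
is a full-rank left annihilator of `(∂g_A/∂z)ᵀ` on the inequality-feasible set. -/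
structure Admissible : Prop where
  κ₁_pos : 0 < D.κ₁
  κ₂_pos : 0 < D.κ₂
  δT_pos : 0 < D.δT
  f_diff : Differentiable ℝ D.f
  f_unbounded : Tendsto D.f (cocompact _) atTop
  grad_unbounded : Tendsto (fun z => ‖gradient D.f z‖) (cocompact _) atTop
  grad_lip : LocallyLipschitz (gradient D.f)
  Aeq_lip : ∀ i j, LocallyLipschitz fun z => D.Aeq z i j
  Aineq_lip : ∀ i j, LocallyLipschitz fun z => D.Aineq z i j
  geq_diff : ∀ i, Differentiable ℝ fun z => D.geq z i
  gineq_diff : ∀ i, Differentiable ℝ fun z => D.gineq z i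
  Jeq_lip : ∀ i j, LocallyLipschitz fun z => D.Jeq z i j
  Jineq_lip : ∀ i j, LocallyLipschitz fun z => D.Jineq z i j
  G_lip : ∀ A ∈ D.S, ∀ i j, LocallyLipschitz fun z => D.G A z i j
  G_annihilates : ∀ A ∈ D.S, ∀ z ∈ D.Gineq, D.G A z * (D.JA A z)ᵀ = 0
  G_rank : ∀ A ∈ D.S, ∀ z ∈ D.Gineq, (D.G A z).rank = n - m - A.card

/-- The technical assumption with constants `β₁ A`, `β₂ A`: on the inequality-feasible set `B_A`
is invertible and `½(B_A + B_Aᵀ) ≥ ½ β₁ B_A B_Aᵀ ≥ β₂ I > 0`. -/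
def DampingBound (β₁ β₂ : Finset (Fin p) → ℝ) : Prop :=
  ∀ A ∈ D.S, 0 < β₁ A ∧ 0 < β₂ A ∧ ∀ z ∈ D.Gineq,
    IsUnit (D.B A z) ∧
    ((1 / 2 : ℝ) • (D.B A z + (D.B A z)ᵀ)
      - (1 / 2 * β₁ A) • (D.B A z * (D.B A z)ᵀ)).PosSemidef ∧
    ((1 / 2 * β₁ A) • (D.B A z * (D.B A z)ᵀ)
      - β₂ A • (1 : Matrix (Fin m ⊕ {i // i ∈ A}) (Fin m ⊕ {i // i ∈ A}) ℝ)).PosSemidef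

/-- The defining property of the constants `φ A`: `[A_A; G_A]ᵀ [A_A; G_A] > φ_A I` on the
inequality-feasible set. -/
def StackBound (φ : Finset (Fin p) → ℝ) : Prop :=
  ∀ A ∈ D.S, 0 < φ A ∧ ∀ z ∈ D.Gineq,
    ((Matrix.fromRows (D.AA A z) (D.G A z))ᵀ * Matrix.fromRows (D.AA A z) (D.G A z)
      - φ A • (1 : Matrix (Fin n) (Fin n) ℝ)).PosDef

/-- The minimum over `S` of a family of constants. -/
def minS (c : Finset (Fin p) → ℝ) : ℝ := D.S.inf' D.S_nonempty c

/-- The set `F`. -/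
def Fset (β₁ β₂ φ : Finset (Fin p) → ℝ) : Set (EuclideanSpace ℝ (Fin n)) :=
  {z | ‖gradient D.f z‖ ^ 2 ≤
    D.κ₁ / (D.minS β₂ * D.minS φ * min (1 / 2 * D.κ₁ * D.minS β₁) D.κ₂)
      * ‖WithLp.toLp 2 (Sum.elim D.deq D.dineq)‖ ^ 2}

/-- Sublevel sets of `f`. -/
def sublevel (c : ℝ) : Set (EuclideanSpace ℝ (Fin n)) := {z | D.f z ≤ c}

/-- `W` is the smallest sublevel set of `f` containing `K`. -/
def IsSmallestSublevel (W K : Set (EuclideanSpace ℝ (Fin n))) : Prop :=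
  (∃ c, W = D.sublevel c) ∧ K ⊆ W ∧ ∀ c, K ⊆ D.sublevel c → W ⊆ D.sublevel c

/-! ### The switching law

A mode `q = (σ, Tₛ)` consists of the active set and of the time of the last removal. -/

/-- The rate of change of the `i`-th inequality constraint along subsystem `A` at `z`. -/
def rate (i : Fin p) (A : Finset (Fin p)) (z : EuclideanSpace ℝ (Fin n)) : ℝ :=
  fderiv ℝ (fun w => D.gineq w i) z (D.h A z)

/-- `P s (y s)` holds at times `s > t` arbitrarily close to `t`, where `y` is the forward solution
of subsystem `A` that starts from `z` at time `t`. -/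
def FreqAfter (t : ℝ) (z : EuclideanSpace ℝ (Fin n)) (A : Finset (Fin p))
    (P : ℝ → EuclideanSpace ℝ (Fin n) → Prop) : Prop :=
  ∃ (ε : ℝ) (y : ℝ → EuclideanSpace ℝ (Fin n)), 0 < ε ∧ y t = z ∧
    (∀ s ∈ Ico t (t + ε), HasDerivWithinAt y (D.h A (y s)) (Ico t (t + ε)) s) ∧
    ∃ᶠ s in 𝓝[>] t, P s (y s)

open Classical in
/-- The indices that the first loop of the switching law adds at the state `z`. -/
def addNow (z : EuclideanSpace ℝ (Fin n)) (A : Finset (Fin p)) : Finset (Fin p) :=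
  Finset.univ.filter fun i => i ∈ D.act z \ A ∧ 0 ≤ D.rate i A z

open Classical in
/-- The indices that the first loop adds immediately after time `t`, if subsystem `A` is
integrated from the state `z`. -/
def addAfter (t : ℝ) (z : EuclideanSpace ℝ (Fin n)) (A : Finset (Fin p)) : Finset (Fin p) :=
  Finset.univ.filter fun i => i ∈ D.act z \ A ∧ D.FreqAfter t z A fun _ y => 0 ≤ D.rate i A y

/-- The second loop removes `i` at time `t`, or immediately after it: `i` is active, and at times
`s > t` arbitrarily close to `t` the constraint would decrease along subsystem `σ \ {i}`, and
`s > Tₛ + δT`. -/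
def RemovalDue (t : ℝ) (z : EuclideanSpace ℝ (Fin n)) (q : Finset (Fin p) × ℝ) (i : Fin p) :
    Prop :=
  i ∈ q.1 ∧ D.FreqAfter t z q.1 fun s y => D.rate i (q.1.erase i) y < 0 ∧ q.2 + D.δT < s

/-- One update of the mode: pending additions are made; if there are none, then the first index
whose removal is due is removed and `Tₛ` is set to `t`. -/
def Update (t : ℝ) (z : EuclideanSpace ℝ (Fin n)) (q q' : Finset (Fin p) × ℝ) : Prop :=
  ((D.addAfter t z q.1).Nonempty ∧ q' = (q.1 ∪ D.addAfter t z q.1, q.2)) ∨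
  (D.addAfter t z q.1 = ∅ ∧ ∃ i, D.RemovalDue t z q i ∧ (∀ j < i, ¬ D.RemovalDue t z q j) ∧
    q' = (q.1.erase i, t))

/-- The switching law maps the mode `q = q(t)` to `q' = q(t⁺)`: the first loop is executed at the
state `z = z(t)`, and then the mode is updated until no update is triggered any more. -/
def Switch (t : ℝ) (z : EuclideanSpace ℝ (Fin n)) (q q' : Finset (Fin p) × ℝ) : Prop :=
  Relation.ReflTransGen (D.Update t z) (q.1 ∪ D.addNow z q.1, q.2) q' ∧
    ∀ q'', ¬ D.Update t z q' q''

/-- The time interval `[0, L)`, with `L = ⊤` allowed. -/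
def horizon (L : EReal) : Set ℝ := {t | 0 ≤ t ∧ (t : EReal) < L}

/-- `(z, q)` with `q = (σ, Tₛ)` is a (Carathéodory) solution of the switched system on `[0, L)`:
`σ(0) = I(z(0))`, `z(t) = z(0) + ∫₀ᵗ h_{σ(τ)}(z(τ)) dτ`, and `q` is piecewise constant with
left-continuous values and with right limits `q(t⁺)` given by the switching law. -/
structure IsSolution (L : EReal) (z : ℝ → EuclideanSpace ℝ (Fin n))
    (q : ℝ → Finset (Fin p) × ℝ) : Prop where
  init : (q 0).1 = D.act (z 0)
  integrable : ∀ t ∈ horizon L,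
    IntervalIntegrable (fun τ => D.h (q τ).1 (z τ)) volume 0 t
  integral_eq : ∀ t ∈ horizon L, z t = z 0 + ∫ τ in (0 : ℝ)..t, D.h (q τ).1 (z τ)
  left_const : ∀ t ∈ horizon L, 0 < t → ∀ᶠ s in 𝓝[<] t, q s = q t
  switch : ∀ t ∈ horizon L, ∃ q', D.Switch t (z t) (q t) q' ∧ ∀ᶠ s in 𝓝[>] t, q s = q'

/-- Solutions of the switched system that start in the inequality-feasible set do not leave `W`
once they are in `W`. -/
def PositivelyInvariant (W : Set (EuclideanSpace ℝ (Fin n))) : Prop :=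
  ∀ (L : EReal) (z : ℝ → EuclideanSpace ℝ (Fin n)) (q : ℝ → Finset (Fin p) × ℝ),
    D.IsSolution L z q → z 0 ∈ D.Gineq →
    ∀ s ∈ horizon L, ∀ t ∈ horizon L, s ≤ t → z s ∈ W → z t ∈ W

end OptData

end

/-!
On the set where `B_A` is invertible, the formula for `h_A` gives `ġᵢ = -κ₁ gᵢ - κ₂ rᵢ` for `i ∈ A`,
where the residual `r` vanishes on the feasible set. By metric regularity of the active constraints,
the distance to the feasible set, and with it `r`, is bounded by the constraint violation, so by
Grönwall's inequality the constraints in `A` that hold with equality keep doing so. The switching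
law adds every other constraint before it is violated; hence the trajectory stays feasible.

On the feasible set, the damping bound yields `ḟ ≤ κ₁ ‖d‖² / (2 β₂) - μ φ ‖∇f‖² / 2` with
`μ = min (κ₁ β₁ / 2) κ₂`, which is negative outside `F`. Without the constants `φ_A` one still has
`ḟ ≤ C ∑ᵢ |g_eq,ᵢ|`, and the right-hand side decays exponentially, so `f` stays bounded along the
trajectory. As removals are separated by the dwell time `δT`, the mode is constant near the end of
every bounded time interval; the trajectory therefore has a limit there and continues beyond it.
Uniqueness follows from that of the subsystems, by induction along the real line.
-/

/-- Pointwise form of `LocallyLipschitz`: `f` is Lipschitz on some neighbourhood of `x`. The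
subsystem vector fields have this property only at the points where `B_A` is invertible. -/
def LocallyLipschitzAt {X Y : Type*} [PseudoMetricSpace X] [PseudoMetricSpace Y] (f : X → Y)
    (x : X) : Prop :=
  ∃ K, ∃ s ∈ 𝓝 x, LipschitzOnWith K f s

namespace LocallyLipschitzAt

section PseudoMetricSpace

variable {X Y Z : Type*} [PseudoMetricSpace X] [PseudoMetricSpace Y] [PseudoMetricSpace Z]
  {f : X → Y} {x : X}

theorem continuousAt (hf : LocallyLipschitzAt f x) : ContinuousAt f x := by
  obtain ⟨K, s, hs, hK⟩ := hf
  exact hK.continuousOn.continuousAt hs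

theorem const (c : Y) : LocallyLipschitzAt (fun _ : X => c) x :=
  ⟨0, univ, univ_mem, (LipschitzWith.const c).lipschitzOnWith⟩

theorem comp {g : Y → Z} (hg : LocallyLipschitzAt g (f x)) (hf : LocallyLipschitzAt f x) :
    LocallyLipschitzAt (fun z => g (f z)) x := by
  have hc := hf.continuousAt
  obtain ⟨K, t, ht, hK⟩ := hg
  obtain ⟨K', s, hs, hK'⟩ := hf
  exact ⟨K * K', s ∩ f ⁻¹' t, inter_mem hs (hc.preimage_mem_nhds ht),
    hK.comp (hK'.mono inter_subset_left) fun z hz => hz.2⟩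

theorem prodMk {g : X → Z} (hf : LocallyLipschitzAt f x) (hg : LocallyLipschitzAt g x) :
    LocallyLipschitzAt (fun z => (f z, g z)) x := by
  obtain ⟨K, s, hs, hK⟩ := hf
  obtain ⟨K', s', hs', hK'⟩ := hg
  exact ⟨_, s ∩ s', inter_mem hs hs',
    (hK.mono inter_subset_left).prodMk (hK'.mono inter_subset_right)⟩

theorem pi {ι : Type*} [Fintype ι] {Y : ι → Type*} [∀ i, PseudoMetricSpace (Y i)]
    {F : X → ∀ i, Y i} (h : ∀ i, LocallyLipschitzAt (fun z => F z i) x) :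
    LocallyLipschitzAt F x := by
  choose K s hs hK using h
  refine ⟨Finset.univ.sup K, ⋂ i, s i, Filter.iInter_mem.2 hs, ?_⟩
  refine LipschitzOnWith.of_dist_le_mul fun a ha b hb => ?_
  refine (dist_pi_le_iff (by positivity)).2 fun i => ?_
  have hKi : K i ≤ Finset.univ.sup K := Finset.le_sup (Finset.mem_univ i)
  calc dist (F a i) (F b i) ≤ K i * dist a b :=
        (hK i).dist_le_mul a (mem_iInter.1 ha i) b (mem_iInter.1 hb i)
    _ ≤ Finset.univ.sup K * dist a b := by gcongr

end PseudoMetricSpace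

section Normed

variable {X E F : Type*} [PseudoMetricSpace X] [NormedAddCommGroup E] [NormedSpace ℝ E]
  [NormedAddCommGroup F] [NormedSpace ℝ F] {x : X}

theorem of_contDiffAt {g : E → F} {y : E} (hg : ContDiffAt ℝ 1 g y) : LocallyLipschitzAt g y :=
  hg.exists_lipschitzOnWith

variable {f g : X → E}

theorem neg (hf : LocallyLipschitzAt f x) : LocallyLipschitzAt (fun z => -f z) x :=
  comp (g := fun q : E => -q) (of_contDiffAt (by fun_prop)) hf

theorem add (hf : LocallyLipschitzAt f x) (hg : LocallyLipschitzAt g x) :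
    LocallyLipschitzAt (fun z => f z + g z) x :=
  comp (g := fun q : E × E => q.1 + q.2) (of_contDiffAt (by fun_prop)) (hf.prodMk hg)

theorem sub (hf : LocallyLipschitzAt f x) (hg : LocallyLipschitzAt g x) :
    LocallyLipschitzAt (fun z => f z - g z) x :=
  comp (g := fun q : E × E => q.1 - q.2) (of_contDiffAt (by fun_prop)) (hf.prodMk hg)

theorem const_smul (c : ℝ) (hf : LocallyLipschitzAt f x) :
    LocallyLipschitzAt (fun z => c • f z) x :=
  comp (g := fun q : E => c • q) (of_contDiffAt (by fun_prop)) hf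

theorem sum {ι : Type*} [Fintype ι] {F : ι → X → E} (h : ∀ i, LocallyLipschitzAt (F i) x) :
    LocallyLipschitzAt (fun z => ∑ i, F i z) x :=
  comp (g := fun v : ι → E => ∑ i, v i) (of_contDiffAt (by fun_prop)) (pi h)

end Normed

section Real

variable {X : Type*} [PseudoMetricSpace X] {x : X} {f g : X → ℝ}

theorem mul (hf : LocallyLipschitzAt f x) (hg : LocallyLipschitzAt g x) :
    LocallyLipschitzAt (fun z => f z * g z) x :=
  comp (g := fun q : ℝ × ℝ => q.1 * q.2) (of_contDiffAt (by fun_prop)) (hf.prodMk hg)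

theorem inv (hf : LocallyLipschitzAt f x) (h0 : f x ≠ 0) :
    LocallyLipschitzAt (fun z => (f z)⁻¹) x :=
  comp (of_contDiffAt (contDiffAt_inv ℝ h0)) hf

theorem prod {ι : Type*} [Fintype ι] {F : ι → X → ℝ} (h : ∀ i, LocallyLipschitzAt (F i) x) :
    LocallyLipschitzAt (fun z => ∏ i, F i z) x :=
  comp (g := fun v : ι → ℝ => ∏ i, v i)
    (of_contDiffAt (contDiff_prod fun i _ => contDiff_apply ℝ ℝ i).contDiffAt) (pi h)

end Real

section Matrix

variable {X ι κ l : Type*} [PseudoMetricSpace X] {x : X} [Fintype κ]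

theorem matrix_mul {M : X → Matrix ι κ ℝ} {N : X → Matrix κ l ℝ}
    (hM : ∀ i j, LocallyLipschitzAt (fun z => M z i j) x)
    (hN : ∀ i j, LocallyLipschitzAt (fun z => N z i j) x) (i : ι) (j : l) :
    LocallyLipschitzAt (fun z => (M z * N z) i j) x := by
  simp only [Matrix.mul_apply]
  exact sum fun k => (hM i k).mul (hN k j)

theorem matrix_mulVec {M : X → Matrix ι κ ℝ} {v : X → κ → ℝ}
    (hM : ∀ i j, LocallyLipschitzAt (fun z => M z i j) x)
    (hv : ∀ i, LocallyLipschitzAt (fun z => v z i) x) (i : ι) :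
    LocallyLipschitzAt (fun z => (M z *ᵥ v z) i) x := by
  simp only [Matrix.mulVec, dotProduct]
  exact sum fun k => (hM i k).mul (hv k)

variable [DecidableEq κ] {M : X → Matrix κ κ ℝ}

theorem matrix_det (hM : ∀ i j, LocallyLipschitzAt (fun z => M z i j) x) :
    LocallyLipschitzAt (fun z => (M z).det) x := by
  simp only [Matrix.det_apply']
  exact sum fun σ => (const _).mul (prod fun i => hM _ _)

theorem matrix_inv (hM : ∀ i j, LocallyLipschitzAt (fun z => M z i j) x) (hu : IsUnit (M x))
    (i j : κ) : LocallyLipschitzAt (fun z => (M z)⁻¹ i j) x := by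
  have hdet : (M x).det ≠ 0 := ((Matrix.isUnit_iff_isUnit_det _).1 hu).ne_zero
  simp only [Matrix.inv_def, Ring.inverse_eq_inv', Matrix.smul_apply, smul_eq_mul,
    Matrix.adjugate_apply]
  refine ((matrix_det hM).inv hdet).mul (matrix_det fun k l => ?_)
  by_cases hk : k = j
  · simpa [hk] using const _
  · simpa [Matrix.updateRow_ne hk] using hM k l

end Matrix

end LocallyLipschitzAt

section IntegralCurve

variable {E : Type*} [NormedAddCommGroup E] [NormedSpace ℝ E]

/-- `γ` is an integral curve of the autonomous vector field `v` on some interval `[t, b)` with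
`t < b`: the one-sided analogue of `IsIntegralCurveAt`, which describes the motion of a switched
system immediately after time `t`. -/
def IsIntegralCurveAfter (γ : ℝ → E) (v : E → E) (t : ℝ) : Prop :=
  ∃ b > t, IsIntegralCurveOn γ (fun _ => v) (Ico t b)

namespace IsIntegralCurveAfter

variable {γ γ₁ γ₂ : ℝ → E} {v : E → E} {t b : ℝ}

theorem exists_Icc (h : IsIntegralCurveAfter γ v t) {P : ℝ → Prop} (hP : ∀ᶠ s in 𝓝[≥] t, P s) :
    ∃ c > t, (∀ s ∈ Icc t c, P s) ∧ ContinuousOn γ (Icc t c) ∧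
      ∀ s ∈ Ico t c, HasDerivWithinAt γ (v (γ s)) (Ici s) s := by
  obtain ⟨b, hb, hγ⟩ := h
  obtain ⟨c, hc, hsub⟩ := mem_nhdsGE_iff_exists_Icc_subset.1 (inter_mem hP (Ico_mem_nhdsGE hb))
  refine ⟨c, hc, fun s hs => (hsub hs).1, hγ.continuousOn.mono fun s hs => (hsub hs).2,
    fun s hs => ?_⟩
  have hsb : s ∈ Ico t b := (hsub (Ico_subset_Icc_self hs)).2
  exact (hγ s hsb).mono_of_mem_nhdsWithin <| mem_of_superset (Ico_mem_nhdsGE hsb.2)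
    (Ico_subset_Ico_left hsb.1)

theorem eventually_hasDerivWithinAt (h : IsIntegralCurveAfter γ v t) :
    ∀ᶠ s in 𝓝[≥] t, HasDerivWithinAt γ (v (γ s)) (Ici s) s := by
  obtain ⟨c, hc, -, -, hd⟩ := h.exists_Icc (P := fun _ => True) (by simp)
  exact mem_of_superset (Ico_mem_nhdsGE hc) hd

theorem eventually_hasDerivAt (h : IsIntegralCurveAfter γ v t) :
    ∀ᶠ s in 𝓝[>] t, HasDerivAt γ (v (γ s)) s := by
  obtain ⟨b, hb, hγ⟩ := h
  filter_upwards [Ioo_mem_nhdsGT hb] with s hs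
  exact (hγ s (Ioo_subset_Ico_self hs)).hasDerivAt (Ico_mem_nhds hs.1 hs.2)

theorem eventually_isIntegralCurveAfter (h : IsIntegralCurveAfter γ v t) :
    ∀ᶠ s in 𝓝[>] t, IsIntegralCurveAfter γ v s := by
  obtain ⟨b, hb, hγ⟩ := h
  filter_upwards [Ioo_mem_nhdsGT hb] with s hs
  exact ⟨b, hs.2, hγ.mono (Ico_subset_Ico_left hs.1.le)⟩

theorem continuousWithinAt (h : IsIntegralCurveAfter γ v t) : ContinuousWithinAt γ (Ici t) t :=
  (h.eventually_hasDerivWithinAt.self_of_nhdsWithin self_mem_Ici).continuousWithinAt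

theorem eventually (h : IsIntegralCurveAfter γ v t) {P : E → Prop} (hP : ∀ᶠ x in 𝓝 (γ t), P x) :
    ∀ᶠ s in 𝓝[≥] t, P (γ s) :=
  h.continuousWithinAt.eventually hP

theorem exists_of_locallyLipschitzAt [CompleteSpace E] {x : E} (hv : LocallyLipschitzAt v x)
    (t : ℝ) : ∃ γ, γ t = x ∧ IsIntegralCurveAfter γ v t := by
  have hbound := hv.continuousAt.norm.eventually_lt_const (lt_add_one ‖v x‖)
  obtain ⟨K, U, hU, hK⟩ := hv
  obtain ⟨r, hr, hball⟩ := Metric.nhds_basis_closedBall.mem_iff.1 (inter_mem hU hbound)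
  let M : NNReal := ‖v x‖₊ + 1
  have hM : (0 : ℝ) < M := by positivity
  have hε : 0 < r / M := by positivity
  have hpl : IsPicardLindelof (fun _ => v) (tmin := t) (tmax := t + r / M)
      ⟨t, le_rfl, by linarith⟩ x ⟨r, hr.le⟩ 0 M K := by
    refine .of_time_independent (fun y hy => (hball hy).2.le) (hK.mono fun y hy => (hball hy).1) ?_
    change (M : ℝ) * max (t + r / M - t) (t - t) ≤ r - 0
    rw [max_eq_left (by linarith), add_sub_cancel_left, mul_div_cancel₀ _ hM.ne', sub_zero]
  obtain ⟨γ, hγt, hγ⟩ := hpl.exists_eq_forall_mem_Icc_hasDerivWithinAt₀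
  exact ⟨γ, hγt, t + r / M, by linarith,
    fun s hs => (hγ s (Ico_subset_Icc_self hs)).mono Ico_subset_Icc_self⟩

theorem eventuallyEq (h₁ : IsIntegralCurveAfter γ₁ v t) (h₂ : IsIntegralCurveAfter γ₂ v t)
    (hv : LocallyLipschitzAt v (γ₁ t)) (heq : γ₁ t = γ₂ t) : γ₁ =ᶠ[𝓝[≥] t] γ₂ := by
  obtain ⟨K, U, hU, hK⟩ := hv
  obtain ⟨c₁, hc₁, hU₁, hcont₁, hd₁⟩ := h₁.exists_Icc (h₁.eventually hU)
  obtain ⟨c₂, hc₂, hU₂, hcont₂, hd₂⟩ := h₂.exists_Icc (h₂.eventually (heq ▸ hU))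
  have hle₁ : min c₁ c₂ ≤ c₁ := min_le_left _ _
  have hle₂ : min c₁ c₂ ≤ c₂ := min_le_right _ _
  have hEqOn : EqOn γ₁ γ₂ (Icc t (min c₁ c₂)) :=
    ODE_solution_unique_of_mem_Icc_right (v := fun _ => v) (s := fun _ => U) (fun _ _ => hK)
      (hcont₁.mono (Icc_subset_Icc_right hle₁)) (fun s hs => hd₁ s (Ico_subset_Ico_right hle₁ hs))
      (fun s hs => hU₁ s (Icc_subset_Icc_right hle₁ (Ico_subset_Icc_self hs)))
      (hcont₂.mono (Icc_subset_Icc_right hle₂)) (fun s hs => hd₂ s (Ico_subset_Ico_right hle₂ hs))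
      (fun s hs => hU₂ s (Icc_subset_Icc_right hle₂ (Ico_subset_Icc_self hs))) heq
  exact mem_of_superset (Icc_mem_nhdsGE (lt_min hc₁ hc₂)) hEqOn

theorem of_integral_eq [CompleteSpace E] (htb : t < b) (hc : ContinuousOn γ (Icc t b))
    (hv : ∀ᶠ x in 𝓝 (γ t), ContinuousAt v x)
    (hint : ∀ s ∈ Icc t b, γ s = γ t + ∫ τ in t..s, v (γ τ)) : IsIntegralCurveAfter γ v t := by
  have hcw : ContinuousWithinAt γ (Ici t) t :=
    (hc t (left_mem_Icc.2 htb.le)).mono_of_mem_nhdsWithin (Icc_mem_nhdsGE htb)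
  obtain ⟨c, htc, hsub⟩ := mem_nhdsGE_iff_exists_Icc_subset.1
    (inter_mem (hcw.eventually hv) (Icc_mem_nhdsGE htb))
  have hcb : Icc t c ⊆ Icc t b := fun s hs => (hsub hs).2
  refine ⟨c, htc, fun s hs => ?_⟩
  have hd := ODE.hasDerivWithinAt_picard_Icc (f := fun _ => v) (u := {x | ContinuousAt v x})
    (left_mem_Icc.2 (le_of_lt htc))
    (fun x hx => (hx.2.comp continuousAt_snd).continuousWithinAt)
    (hc.mono hcb) (fun s hs => (hsub hs).1) (γ t) (Ico_subset_Icc_self hs)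
  exact (hd.congr (fun r hr => hint r (hcb hr)) (hint s (hcb (Ico_subset_Icc_self hs)))).mono
    Ico_subset_Icc_self

end IsIntegralCurveAfter

end IntegralCurve

theorem forall_mem_Icc_of_interval_induction {P : ℝ → Prop} {a b : ℝ} (base : P a)
    (left : ∀ t ∈ Ioc a b, (∀ s ∈ Ico a t, P s) → P t)
    (right : ∀ t ∈ Ico a b, (∀ s ∈ Icc a t, P s) → ∀ᶠ s in 𝓝[>] t, P s) :
    ∀ t ∈ Icc a b, P t := by
  let S : Set ℝ := {t | ∀ s ∈ Icc a t, P s}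
  suffices hS : Icc a b ⊆ S from fun t ht => hS ht t (right_mem_Icc.2 ht.1)
  refine IsClosed.Icc_subset_of_forall_mem_nhdsWithin ?_ ?_ ?_
  · refine isClosed_of_closure_subset fun t ht => ?_
    have htI : t ∈ Icc a b := closure_minimal inter_subset_right isClosed_Icc ht
    have hlt : ∀ s ∈ Ico a t, P s := fun s hs => by
      obtain ⟨r, hr, hrS, -⟩ := mem_closure_iff.1 ht (Ioi s) isOpen_Ioi hs.2
      exact hrS s ⟨hs.1, le_of_lt hr⟩
    refine ⟨fun s hs => ?_, htI⟩
    rcases hs.2.eq_or_lt with rfl | hst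
    · exact htI.1.eq_or_lt.elim (fun h => h ▸ base) fun h => left s ⟨h, htI.2⟩ hlt
    · exact hlt s ⟨hs.1, hst⟩
  · intro s hs
    rwa [le_antisymm hs.2 hs.1]
  · rintro t ⟨htS, ht⟩
    obtain ⟨u, hu, hsub⟩ := mem_nhdsGT_iff_exists_Ioo_subset.1 (right t ht htS)
    refine mem_of_superset (Ioo_mem_nhdsGT hu) fun r hr s hs => ?_
    rcases le_or_gt s t with hst | hst
    · exact htS s ⟨hs.1, hst⟩
    · exact hsub ⟨hst, hs.2.trans_lt hr.2⟩

section MetricRegularity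

variable {E F : Type*} [NormedAddCommGroup E] [NormedSpace ℝ E] [NormedAddCommGroup F]
  [NormedSpace ℝ F]

/-- Metric regularity of `g` at `a`: near `(a, g a)` the equation `g w = v` has solutions `w` whose
distance to a given `u` is controlled by the residual `dist (g u) v`. -/
def MetricallyRegularAt (g : E → F) (a : E) : Prop :=
  ∃ C, 0 ≤ C ∧ ∀ s ∈ 𝓝 a, ∀ᶠ q : E × F in 𝓝 (a, g a),
    ∃ w ∈ s, g w = q.2 ∧ dist w q.1 ≤ C * dist (g q.1) q.2

theorem MetricallyRegularAt.of_hasStrictFDerivAt [CompleteSpace E] [CompleteSpace F] {g : E → F}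
    {g' : E →L[ℝ] F} {a : E} (hg : HasStrictFDerivAt g g' a) (hsurj : g'.range = ⊤) :
    MetricallyRegularAt g a := by
  let R := g'.nonlinearRightInverseOfSurjective hsurj
  have hR : 0 < R.nnnorm := g'.nonlinearRightInverseOfSurjective_nnnorm_pos hsurj
  obtain ⟨U, hU, happrox⟩ := hg.approximates_deriv_on_nhds (c := R.nnnorm⁻¹ / 2)
    (Or.inr (by positivity))
  refine ⟨2 * R.nnnorm, by positivity, fun s hs => ?_⟩
  obtain ⟨r, hr, hball⟩ := Metric.mem_nhds_iff.1 (inter_mem hs hU)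
  have hres : ContinuousAt (fun q : E × F => 2 * R.nnnorm * dist (g q.1) q.2) (a, g a) := by
    have hga : ContinuousAt (fun q : E × F => g q.1) (a, g a) :=
      hg.continuousAt.comp continuousAt_fst
    exact continuousAt_const.mul (hga.dist continuousAt_snd)
  have hsmall : ∀ᶠ q : E × F in 𝓝 (a, g a), 2 * R.nnnorm * dist (g q.1) q.2 < r / 2 :=
    hres.eventually_lt_const (by simpa using hr)
  filter_upwards [hsmall,
    continuousAt_fst.eventually (Metric.ball_mem_nhds a (half_pos hr))] with q hq hqa
  have hsub : Metric.closedBall q.1 (2 * R.nnnorm * dist (g q.1) q.2) ⊆ Metric.ball a r :=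
    Metric.closedBall_subset_ball' (by linarith [Metric.mem_ball.1 hqa])
  have htarget : q.2 ∈ Metric.closedBall (g q.1)
      (((R.nnnorm : ℝ)⁻¹ - (R.nnnorm⁻¹ / 2 : NNReal)) * (2 * R.nnnorm * dist (g q.1) q.2)) := by
    rw [Metric.mem_closedBall, dist_comm]
    have : (R.nnnorm : ℝ) ≠ 0 := by positivity
    refine le_of_eq ?_
    push_cast
    field_simp
    ring
  obtain ⟨w, hw, hgw⟩ := happrox.surjOn_closedBall_of_nonlinearRightInverse R (by positivity)
    (hsub.trans fun w hw => (hball hw).2) htarget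
  exact ⟨w, (hball (hsub hw)).1, hgw, Metric.mem_closedBall.1 hw⟩

end MetricRegularity

theorem isCompact_le_of_tendsto_cocompact_atTop {X : Type*} [TopologicalSpace X] {g : X → ℝ}
    (hg : Continuous g) (hlim : Tendsto g (cocompact X) atTop) (c : ℝ) :
    IsCompact {x | g x ≤ c} := by
  obtain ⟨K, hK, hsub⟩ := mem_cocompact.1 (hlim.eventually_gt_atTop c)
  refine hK.of_isClosed_subset (isClosed_le hg continuous_const) fun x (hx : g x ≤ c) => ?_
  by_contra h
  exact hx.not_gt (hsub h)

namespace OptData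

variable {n m p : ℕ} {D : OptData n m p} {A : Finset (Fin p)} {z : EuclideanSpace ℝ (Fin n)}
  {i : Fin p}

theorem mem_act : i ∈ D.act z ↔ D.gineq z i = 0 := by
  simp [act]

theorem mem_S_of_subset_act (h : A ⊆ D.act z) : A ∈ D.S := by
  simp only [S, Finset.mem_filter, Finset.mem_univ, true_and]
  exact ⟨z, h⟩

theorem gineq_neg_of_notMem_act (hz : z ∈ D.Gineq) (hi : i ∉ D.act z) : D.gineq z i < 0 :=
  (hz i).lt_of_ne (mt mem_act.2 hi)

/-- The vector `g_A` of all constraints that subsystem `A` treats as equalities. -/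
noncomputable def gA (D : OptData n m p) (A : Finset (Fin p)) (z : EuclideanSpace ℝ (Fin n)) :
    Fin m ⊕ {i // i ∈ A} → ℝ :=
  D.AA A z *ᵥ D.grad z + D.dA A

/-- The rate of change of the inequality constraints that is due to the component
`G_Aᵀ G_A ∇f` of the vector field. For active constraints it vanishes on the feasible set, but in
general not elsewhere. -/
noncomputable def residual (D : OptData n m p) (A : Finset (Fin p))
    (z : EuclideanSpace ℝ (Fin n)) : Fin p → ℝ :=
  (D.Jineq z * ((D.G A z)ᵀ * D.G A z)) *ᵥ D.grad z

/-- The consequences of `Admissible` and `DampingBound` that the analysis of the switching law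
needs: every `B_A` is invertible on the feasible set. -/
structure WellPosed (D : OptData n m p) : Prop extends D.Admissible where
  isUnit_B : ∀ {A}, A ∈ D.S → ∀ {z}, z ∈ D.Gineq → IsUnit (D.B A z)

theorem DampingBound.wellPosed {β₁ β₂ : Finset (Fin p) → ℝ} (hβ : D.DampingBound β₁ β₂)
    (hD : D.Admissible) : D.WellPosed :=
  { hD with isUnit_B := fun hA _ hz => ((hβ _ hA).2.2 _ hz).1 }

namespace Admissible

theorem continuous_gineq (hD : D.Admissible) (i : Fin p) : Continuous fun z => D.gineq z i :=
  (hD.gineq_diff i).continuous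

theorem isClosed_Gineq (hD : D.Admissible) : IsClosed D.Gineq := by
  simp only [Gineq, ofPred_forall]
  exact isClosed_iInter fun i => isClosed_le (hD.continuous_gineq i) continuous_const

theorem isCompact_sublevel (hD : D.Admissible) (c : ℝ) : IsCompact (D.sublevel c) :=
  isCompact_le_of_tendsto_cocompact_atTop hD.f_diff.continuous hD.f_unbounded c

theorem isCompact_Fset (hD : D.Admissible) (β₁ β₂ φ : Finset (Fin p) → ℝ) :
    IsCompact (D.Fset β₁ β₂ φ) :=
  isCompact_le_of_tendsto_cocompact_atTop (hD.grad_lip.continuous.norm.pow 2)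
    ((tendsto_pow_atTop two_ne_zero).comp hD.grad_unbounded) _

theorem locallyLipschitzAt_grad (hD : D.Admissible) (j : Fin n) :
    LocallyLipschitzAt (fun z => D.grad z j) z :=
  .comp (g := fun v : EuclideanSpace ℝ (Fin n) => v j)
    (.of_contDiffAt (EuclideanSpace.proj (𝕜 := ℝ) j).contDiff.contDiffAt) (hD.grad_lip z)

theorem locallyLipschitzAt_AA (hD : D.Admissible) (i : Fin m ⊕ {i // i ∈ A}) (j : Fin n) :
    LocallyLipschitzAt (fun z => D.AA A z i j) z :=
  i.casesOn (fun i => hD.Aeq_lip i j z) fun i => hD.Aineq_lip i j z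

theorem locallyLipschitzAt_JA (hD : D.Admissible) (i : Fin m ⊕ {i // i ∈ A}) (j : Fin n) :
    LocallyLipschitzAt (fun z => D.JA A z i j) z :=
  i.casesOn (fun i => hD.Jeq_lip i j z) fun i => hD.Jineq_lip i j z

theorem locallyLipschitzAt_B (hD : D.Admissible) (i j : Fin m ⊕ {i // i ∈ A}) :
    LocallyLipschitzAt (fun z => D.B A z i j) z :=
  .matrix_mul hD.locallyLipschitzAt_JA (fun i j => hD.locallyLipschitzAt_AA j i) i j

theorem locallyLipschitzAt_G_transpose_mul_G (hD : D.Admissible) (hA : A ∈ D.S) (i j : Fin n) :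
    LocallyLipschitzAt (fun z => ((D.G A z)ᵀ * D.G A z) i j) z :=
  .matrix_mul (fun i j => hD.G_lip A hA j i z) (fun i j => hD.G_lip A hA i j z) i j

theorem locallyLipschitzAt_residual (hD : D.Admissible) (hA : A ∈ D.S) (i : Fin p) :
    LocallyLipschitzAt (fun z => D.residual A z i) z :=
  .matrix_mulVec (.matrix_mul (fun i j => hD.Jineq_lip i j z)
    (hD.locallyLipschitzAt_G_transpose_mul_G hA)) hD.locallyLipschitzAt_grad i

theorem eventually_isUnit_B (hD : D.Admissible) (h : IsUnit (D.B A z)) :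
    ∀ᶠ w in 𝓝 z, IsUnit (D.B A w) := by
  have hdet := (LocallyLipschitzAt.matrix_det
    (hD.locallyLipschitzAt_B (A := A) (z := z))).continuousAt
  filter_upwards [hdet.eventually_ne ((Matrix.isUnit_iff_isUnit_det _).1 h).ne_zero] with w hw
  exact (Matrix.isUnit_iff_isUnit_det _).2 (isUnit_iff_ne_zero.2 hw)

end Admissible

theorem WellPosed.eventually_locallyLipschitzAt_h (hD : D.WellPosed) (hA : A ∈ D.S)
    (hz : z ∈ D.Gineq) : ∀ᶠ w in 𝓝 z, LocallyLipschitzAt (D.h A) w := by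
  filter_upwards [hD.eventually_isUnit_B (hD.isUnit_B hA hz)] with w hB
  have hAB : ∀ i j, LocallyLipschitzAt (fun z => ((D.AA A z)ᵀ * (D.B A z)⁻¹) i j) w :=
    .matrix_mul (M := fun z => (D.AA A z)ᵀ) (fun i j => hD.locallyLipschitzAt_AA j i)
      (.matrix_inv hD.locallyLipschitzAt_B hB)
  have hABA : ∀ i j, LocallyLipschitzAt
      (fun z => ((D.AA A z)ᵀ * (D.B A z)⁻¹ * D.AA A z) i j) w :=
    .matrix_mul (M := fun z => (D.AA A z)ᵀ * (D.B A z)⁻¹) hAB hD.locallyLipschitzAt_AA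
  have hmat : ∀ i j, LocallyLipschitzAt (fun z => (D.κ₁ • ((D.AA A z)ᵀ * (D.B A z)⁻¹ * D.AA A z)
      + D.κ₂ • ((D.G A z)ᵀ * D.G A z)) i j) w := fun i j =>
    ((hABA i j).const_smul D.κ₁).add
      ((hD.locallyLipschitzAt_G_transpose_mul_G hA i j).const_smul D.κ₂)
  have hgrad := LocallyLipschitzAt.matrix_mulVec hmat (v := D.grad) hD.locallyLipschitzAt_grad
  have hd := LocallyLipschitzAt.matrix_mulVec hAB (v := fun _ => D.dA A) fun j => .const _
  exact .comp (g := WithLp.toLp 2)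
    (.of_contDiffAt (PiLp.contDiff_toLp (𝕜 := ℝ) (p := 2)).contDiffAt)
    (.pi fun i => (hgrad i).neg.sub ((hd i).const_smul D.κ₁))

theorem WellPosed.locallyLipschitzAt_h (hD : D.WellPosed) (hA : A ∈ D.S) (hz : z ∈ D.Gineq) :
    LocallyLipschitzAt (D.h A) z :=
  (hD.eventually_locallyLipschitzAt_h hA hz).self_of_nhds

theorem clm_apply_eq_sum_single (L : EuclideanSpace ℝ (Fin n) →L[ℝ] ℝ)
    (v : EuclideanSpace ℝ (Fin n)) : L v = ∑ j, L (EuclideanSpace.single j 1) * v j := by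
  conv_lhs => rw [← (EuclideanSpace.basisFun (Fin n) ℝ).sum_repr v]
  simp [mul_comm]

theorem fderiv_gineq_apply (v : EuclideanSpace ℝ (Fin n)) :
    fderiv ℝ (fun w => D.gineq w i) z v = (D.Jineq z *ᵥ v.ofLp) i :=
  clm_apply_eq_sum_single _ v

theorem fderiv_geq_apply (i : Fin m) (v : EuclideanSpace ℝ (Fin n)) :
    fderiv ℝ (fun w => D.geq w i) z v = (D.Jeq z *ᵥ v.ofLp) i :=
  clm_apply_eq_sum_single _ v

theorem Admissible.hasStrictFDerivAt_gineq (hD : D.Admissible) (i : Fin p) :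
    HasStrictFDerivAt (fun w => D.gineq w i) (fderiv ℝ (fun w => D.gineq w i) z) z := by
  refine hasStrictFDerivAt_of_hasFDerivAt_of_continuousAt (f' := fderiv ℝ fun w => D.gineq w i)
    (.of_forall fun w => (hD.gineq_diff i w).hasFDerivAt) (Continuous.continuousAt ?_)
  refine continuous_clm_apply.2 fun v => ?_
  simp_rw [clm_apply_eq_sum_single _ v]
  exact continuous_finsetSum _ fun j _ => (hD.Jineq_lip i j).continuous.mul continuous_const

theorem gA_eq : D.gA A z = Sum.elim (D.geq z) fun i => D.gineq z i.1 := by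
  funext i
  cases i <;> rfl

theorem JA_mulVec (v : Fin n → ℝ) :
    D.JA A z *ᵥ v = Sum.elim (D.Jeq z *ᵥ v) fun i => (D.Jineq z *ᵥ v) i.1 := by
  funext i
  cases i <;> rfl

theorem ofLp_h : (D.h A z).ofLp = -(D.κ₁ • ((D.AA A z)ᵀ *ᵥ ((D.B A z)⁻¹ *ᵥ D.gA A z)))
    - D.κ₂ • (((D.G A z)ᵀ * D.G A z) *ᵥ D.grad z) := by
  simp only [h, gA, Matrix.add_mulVec, Matrix.mulVec_add, Matrix.smul_mulVec, smul_add,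
    Matrix.mulVec_mulVec, Matrix.mul_assoc]
  abel

theorem JA_mulVec_AA_transpose_mulVec_inv (hB : IsUnit (D.B A z))
    (u : Fin m ⊕ {i // i ∈ A} → ℝ) :
    D.JA A z *ᵥ ((D.AA A z)ᵀ *ᵥ ((D.B A z)⁻¹ *ᵥ u)) = u := by
  rw [Matrix.mulVec_mulVec _ (D.JA A z), ← B, Matrix.mulVec_mulVec,
    Matrix.mul_nonsing_inv _ ((Matrix.isUnit_iff_isUnit_det _).1 hB), Matrix.one_mulVec]

theorem JA_mulVec_h (hB : IsUnit (D.B A z)) :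
    D.JA A z *ᵥ (D.h A z).ofLp = -(D.κ₁ • D.gA A z)
      - D.κ₂ • (D.JA A z *ᵥ (((D.G A z)ᵀ * D.G A z) *ᵥ D.grad z)) := by
  rw [ofLp_h, Matrix.mulVec_sub, Matrix.mulVec_neg, Matrix.mulVec_smul, Matrix.mulVec_smul,
    JA_mulVec_AA_transpose_mulVec_inv hB]

theorem rate_of_mem (hB : IsUnit (D.B A z)) (hi : i ∈ A) :
    D.rate i A z = -(D.κ₁ * D.gineq z i) - D.κ₂ * D.residual A z i := by
  have h := congrFun (JA_mulVec_h hB) (Sum.inr ⟨i, hi⟩)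
  simp only [JA_mulVec, gA_eq, Sum.elim_inr, Pi.sub_apply, Pi.neg_apply, Pi.smul_apply,
    smul_eq_mul] at h
  rw [rate, fderiv_gineq_apply, h, residual, Matrix.mulVec_mulVec]

theorem Admissible.JA_mulVec_G (hD : D.Admissible) (hA : A ∈ D.S) (hz : z ∈ D.Gineq) :
    D.JA A z *ᵥ (((D.G A z)ᵀ * D.G A z) *ᵥ D.grad z) = 0 := by
  have h : D.JA A z * (D.G A z)ᵀ = 0 := by
    rw [← Matrix.transpose_transpose (D.JA A z), ← Matrix.transpose_mul,
      hD.G_annihilates A hA z hz, Matrix.transpose_zero]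
  rw [Matrix.mulVec_mulVec, ← Matrix.mul_assoc, h, Matrix.zero_mul, Matrix.zero_mulVec]

theorem Admissible.residual_eq_zero (hD : D.Admissible) (hA : A ∈ D.S) (hz : z ∈ D.Gineq)
    (hi : i ∈ A) : D.residual A z i = 0 := by
  have h := congrFun (hD.JA_mulVec_G hA hz) (Sum.inr ⟨i, hi⟩)
  rw [JA_mulVec] at h
  rw [residual, ← Matrix.mulVec_mulVec]
  exact h

theorem WellPosed.fderiv_geq_h (hD : D.WellPosed) (hA : A ∈ D.S) (hz : z ∈ D.Gineq) (i : Fin m) :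
    fderiv ℝ (fun w => D.geq w i) z (D.h A z) = -(D.κ₁ * D.geq z i) := by
  have h := congrFun (JA_mulVec_h (hD.isUnit_B hA hz)) (Sum.inl i)
  rw [hD.JA_mulVec_G hA hz, JA_mulVec, gA_eq] at h
  rw [fderiv_geq_apply]
  simpa using h

theorem fderiv_f_h : fderiv ℝ D.f z (D.h A z)
    = -(D.κ₁ * ((D.AA A z *ᵥ D.grad z) ⬝ᵥ ((D.B A z)⁻¹ *ᵥ D.gA A z)))
      - D.κ₂ * ((D.G A z *ᵥ D.grad z) ⬝ᵥ (D.G A z *ᵥ D.grad z)) := by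
  have hdot : fderiv ℝ D.f z (D.h A z) = D.grad z ⬝ᵥ (D.h A z).ofLp := by
    rw [← inner_gradient_left, EuclideanSpace.inner_eq_star_dotProduct, star_trivial,
      dotProduct_comm]
    rfl
  rw [hdot, ofLp_h, dotProduct_sub, dotProduct_neg, dotProduct_smul, dotProduct_smul,
    Matrix.dotProduct_mulVec _ (D.AA A z)ᵀ, Matrix.vecMul_transpose, ← Matrix.mulVec_mulVec,
    Matrix.dotProduct_mulVec _ (D.G A z)ᵀ, Matrix.vecMul_transpose, smul_eq_mul, smul_eq_mul]

end OptData

section DotProduct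

variable {ι : Type*} [Fintype ι]

theorem dotProduct_self_nonneg_real (x : ι → ℝ) : 0 ≤ x ⬝ᵥ x :=
  dotProduct_self_star_nonneg x

theorem neg_dotProduct_le {c : ℝ} (hc : 0 < c) (x d : ι → ℝ) :
    -(x ⬝ᵥ d) ≤ c / 2 * (x ⬝ᵥ x) + (d ⬝ᵥ d) / (2 * c) := by
  simp only [dotProduct, Finset.mul_sum, Finset.sum_div, ← Finset.sum_neg_distrib,
    ← Finset.sum_add_distrib]
  refine Finset.sum_le_sum fun i _ => ?_
  have hsq : c / 2 * (x i * x i) + d i * d i / (2 * c) - -(x i * d i)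
      = (c * x i + d i) ^ 2 / (2 * c) := by
    field_simp
    ring
  have : 0 ≤ (c * x i + d i) ^ 2 / (2 * c) := by positivity
  linarith

theorem dotProduct_le_sqrt_mul_sum_abs (x y : ι → ℝ) :
    x ⬝ᵥ y ≤ √(x ⬝ᵥ x) * ∑ i, |y i| := by
  simp only [dotProduct, Finset.mul_sum]
  refine Finset.sum_le_sum fun i _ => ?_
  have hxi : |x i| ≤ √(∑ j, x j * x j) := Real.abs_le_sqrt <| (sq (x i)).trans_le <|
    Finset.single_le_sum (f := fun j => x j * x j) (fun j _ => mul_self_nonneg _)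
      (Finset.mem_univ i)
  calc x i * y i ≤ |x i| * |y i| := (le_abs_self _).trans_eq (abs_mul _ _)
    _ ≤ _ := by gcongr

variable {B : Matrix ι ι ℝ} {b c : ℝ}

theorem dotProduct_mul_transpose_mulVec (x : ι → ℝ) :
    x ⬝ᵥ ((B * Bᵀ) *ᵥ x) = (x ᵥ* B) ⬝ᵥ (x ᵥ* B) := by
  rw [← Matrix.mulVec_mulVec, Matrix.dotProduct_mulVec, Matrix.mulVec_transpose]

variable [DecidableEq ι]

theorem vecMul_inv_vecMul (hB : IsUnit B) (v : ι → ℝ) : (v ᵥ* B⁻¹) ᵥ* B = v := by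
  rw [Matrix.vecMul_vecMul, Matrix.nonsing_inv_mul _ ((Matrix.isUnit_iff_isUnit_det _).1 hB),
    Matrix.vecMul_one]

theorem mul_dotProduct_self_le_dotProduct_inv_mulVec (hB : IsUnit B)
    (h : ((1 / 2 : ℝ) • (B + Bᵀ) - (1 / 2 * b) • (B * Bᵀ)).PosSemidef) (v : ι → ℝ) :
    1 / 2 * b * (v ⬝ᵥ v) ≤ v ⬝ᵥ (B⁻¹ *ᵥ v) := by
  have hsymm : (v ᵥ* B⁻¹) ⬝ᵥ (Bᵀ *ᵥ (v ᵥ* B⁻¹)) = (v ᵥ* B⁻¹) ⬝ᵥ (B *ᵥ (v ᵥ* B⁻¹)) := by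
    rw [Matrix.mulVec_transpose, dotProduct_comm, Matrix.dotProduct_mulVec]
  have hquad : (v ᵥ* B⁻¹) ⬝ᵥ (B *ᵥ (v ᵥ* B⁻¹)) = v ⬝ᵥ (B⁻¹ *ᵥ v) := by
    rw [Matrix.dotProduct_mulVec, vecMul_inv_vecMul hB, dotProduct_comm,
      ← Matrix.dotProduct_mulVec]
  have hpsd := h.dotProduct_mulVec_nonneg (v ᵥ* B⁻¹)
  simp only [star_trivial, Matrix.sub_mulVec, Matrix.smul_mulVec, Matrix.add_mulVec,
    dotProduct_sub, dotProduct_smul, dotProduct_add, smul_eq_mul, hsymm, hquad,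
    dotProduct_mul_transpose_mulVec, vecMul_inv_vecMul hB] at hpsd
  linarith

theorem mul_dotProduct_self_vecMul_inv_le (hB : IsUnit B)
    (h : ((1 / 2 * b) • (B * Bᵀ) - c • (1 : Matrix ι ι ℝ)).PosSemidef) (v : ι → ℝ) :
    c * ((v ᵥ* B⁻¹) ⬝ᵥ (v ᵥ* B⁻¹)) ≤ 1 / 2 * b * (v ⬝ᵥ v) := by
  have hpsd := h.dotProduct_mulVec_nonneg (v ᵥ* B⁻¹)
  simp only [star_trivial, Matrix.sub_mulVec, Matrix.smul_mulVec, Matrix.one_mulVec,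
    dotProduct_sub, dotProduct_smul, smul_eq_mul, dotProduct_mul_transpose_mulVec,
    vecMul_inv_vecMul hB] at hpsd
  linarith

theorem neg_dotProduct_inv_mulVec_le (hB : IsUnit B) (hc : 0 < c)
    (h₁ : ((1 / 2 : ℝ) • (B + Bᵀ) - (1 / 2 * b) • (B * Bᵀ)).PosSemidef)
    (h₂ : ((1 / 2 * b) • (B * Bᵀ) - c • (1 : Matrix ι ι ℝ)).PosSemidef) (v d : ι → ℝ) :
    -(v ⬝ᵥ (B⁻¹ *ᵥ d)) ≤ 1 / 2 * (v ⬝ᵥ (B⁻¹ *ᵥ v)) + (d ⬝ᵥ d) / (2 * c) := by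
  have young := neg_dotProduct_le hc (v ᵥ* B⁻¹) d
  have hlower := mul_dotProduct_self_le_dotProduct_inv_mulVec hB h₁ v
  have hupper := mul_dotProduct_self_vecMul_inv_le hB h₂ v
  rw [Matrix.dotProduct_mulVec v B⁻¹ d]
  linarith

end DotProduct

namespace OptData

variable {n m p : ℕ} {D : OptData n m p} {A : Finset (Fin p)} {z : EuclideanSpace ℝ (Fin n)}
  {β₁ β₂ φ : Finset (Fin p) → ℝ}

theorem minS_pos {c : Finset (Fin p) → ℝ} (h : ∀ A ∈ D.S, 0 < c A) : 0 < D.minS c :=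
  (Finset.lt_inf'_iff _).2 h

theorem minS_le {c : Finset (Fin p) → ℝ} (hA : A ∈ D.S) : D.minS c ≤ c A :=
  Finset.inf'_le _ hA

theorem dA_dotProduct_self_le :
    D.dA A ⬝ᵥ D.dA A ≤ ‖WithLp.toLp 2 (Sum.elim D.deq D.dineq)‖ ^ 2 := by
  rw [EuclideanSpace.real_norm_sq_eq]
  simp only [dotProduct, Fintype.sum_sum_type, dA, Sum.elim_inl, Sum.elim_inr, ← sq]
  gcongr
  rw [Finset.sum_coe_sort A fun i => D.dineq i ^ 2]
  exact Finset.sum_le_sum_of_subset_of_nonneg (Finset.subset_univ _) fun i _ _ => sq_nonneg _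

theorem StackBound.mul_norm_gradient_sq_le (hφ : D.StackBound φ) (hA : A ∈ D.S)
    (hz : z ∈ D.Gineq) : φ A * ‖gradient D.f z‖ ^ 2 ≤
      (D.AA A z *ᵥ D.grad z) ⬝ᵥ (D.AA A z *ᵥ D.grad z)
        + (D.G A z *ᵥ D.grad z) ⬝ᵥ (D.G A z *ᵥ D.grad z) := by
  have hgrad : ‖gradient D.f z‖ ^ 2 = D.grad z ⬝ᵥ D.grad z := by
    simp only [EuclideanSpace.real_norm_sq_eq, dotProduct, ← sq]
    rfl
  have hpsd := ((hφ A hA).2 z hz).posSemidef.dotProduct_mulVec_nonneg (D.grad z)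
  rw [star_trivial, Matrix.sub_mulVec, dotProduct_sub, Matrix.smul_mulVec, Matrix.one_mulVec,
    dotProduct_smul, ← Matrix.mulVec_mulVec, Matrix.dotProduct_mulVec, Matrix.vecMul_transpose,
    Matrix.fromRows_mulVec] at hpsd
  rw [hgrad]
  simp only [dotProduct, Fintype.sum_sum_type, Sum.elim_inl, Sum.elim_inr, smul_eq_mul] at hpsd ⊢
  linarith

namespace DampingBound

theorem fderiv_f_h_le (hD : D.Admissible) (hβ : D.DampingBound β₁ β₂) (hφ : D.StackBound φ)
    (hA : A ∈ D.S) (hz : z ∈ D.Gineq) : fderiv ℝ D.f z (D.h A z) ≤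
      D.κ₁ * ((D.dA A ⬝ᵥ D.dA A) / (2 * β₂ A))
        - 1 / 2 * min (1 / 2 * D.κ₁ * β₁ A) D.κ₂ * (φ A * ‖gradient D.f z‖ ^ 2) := by
  obtain ⟨hβ₁, hβ₂, hdamp⟩ := hβ A hA
  obtain ⟨hB, hpsd₁, hpsd₂⟩ := hdamp z hz
  have hκ₁ := hD.κ₁_pos
  have hκ₂ := hD.κ₂_pos
  rw [fderiv_f_h, gA, Matrix.mulVec_add, dotProduct_add]
  have hstack := hφ.mul_norm_gradient_sq_le hA hz
  set v := D.AA A z *ᵥ D.grad z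
  set y := D.G A z *ᵥ D.grad z
  have hv := dotProduct_self_nonneg_real v
  have hy := dotProduct_self_nonneg_real y
  have hcross := mul_le_mul_of_nonneg_left
    (neg_dotProduct_inv_mulVec_le hB hβ₂ hpsd₁ hpsd₂ v (D.dA A)) hκ₁.le
  have hquad := mul_le_mul_of_nonneg_left
    (mul_dotProduct_self_le_dotProduct_inv_mulVec hB hpsd₁ v) hκ₁.le
  have hμv : min (1 / 2 * D.κ₁ * β₁ A) D.κ₂ * (v ⬝ᵥ v) ≤ 1 / 2 * D.κ₁ * β₁ A * (v ⬝ᵥ v) := by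
    gcongr
    exact min_le_left _ _
  have hμy : min (1 / 2 * D.κ₁ * β₁ A) D.κ₂ * (y ⬝ᵥ y) ≤ D.κ₂ * (y ⬝ᵥ y) := by
    gcongr
    exact min_le_right _ _
  have hκy : 0 ≤ D.κ₂ * (y ⬝ᵥ y) := by positivity
  have hμ := mul_le_mul_of_nonneg_left hstack
    (show 0 ≤ min (1 / 2 * D.κ₁ * β₁ A) D.κ₂ by positivity)
  linarith

theorem fderiv_f_h_neg (hD : D.Admissible) (hβ : D.DampingBound β₁ β₂) (hφ : D.StackBound φ)
    (hA : A ∈ D.S) (hz : z ∈ D.Gineq) (hF : z ∉ D.Fset β₁ β₂ φ) :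
    fderiv ℝ D.f z (D.h A z) < 0 := by
  have hκ₁ := hD.κ₁_pos
  have hκ₂ := hD.κ₂_pos
  have hb₁ : 0 < D.minS β₁ := minS_pos fun A hA => (hβ A hA).1
  have hb₂ : 0 < D.minS β₂ := minS_pos fun A hA => (hβ A hA).2.1
  have hφ₀ : 0 < D.minS φ := minS_pos fun A hA => (hφ A hA).1
  have hμ : 0 < min (1 / 2 * D.κ₁ * D.minS β₁) D.κ₂ := by positivity
  rw [Fset, mem_ofPred_eq, not_le, div_mul_eq_mul_div, div_lt_iff₀ (by positivity)] at hF
  have hd : D.κ₁ * ((D.dA A ⬝ᵥ D.dA A) / (2 * β₂ A)) ≤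
      D.κ₁ * (‖WithLp.toLp 2 (Sum.elim D.deq D.dineq)‖ ^ 2 / (2 * D.minS β₂)) := by
    gcongr
    · exact dA_dotProduct_self_le
    · exact minS_le hA
  have hgrad : 1 / 2 * min (1 / 2 * D.κ₁ * D.minS β₁) D.κ₂ * (D.minS φ * ‖gradient D.f z‖ ^ 2) ≤
      1 / 2 * min (1 / 2 * D.κ₁ * β₁ A) D.κ₂ * (φ A * ‖gradient D.f z‖ ^ 2) := by
    have hβ₁A := (hβ A hA).1
    gcongr
    · exact minS_le hA
    · exact minS_le hA
  have hoff : D.κ₁ * (‖WithLp.toLp 2 (Sum.elim D.deq D.dineq)‖ ^ 2 / (2 * D.minS β₂)) <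
      1 / 2 * min (1 / 2 * D.κ₁ * D.minS β₁) D.κ₂ * (D.minS φ * ‖gradient D.f z‖ ^ 2) := by
    rw [mul_div_assoc', div_lt_iff₀ (by positivity)]
    linarith
  linarith [hβ.fderiv_f_h_le hD hφ hA hz]

theorem fderiv_f_h_le_mul_sum_abs_gA (hD : D.Admissible) (hβ : D.DampingBound β₁ β₂)
    (hA : A ∈ D.S) (hz : z ∈ D.Gineq) : fderiv ℝ D.f z (D.h A z) ≤
      D.κ₁ * √(1 / 2 * β₁ A * (D.dA A ⬝ᵥ D.dA A) / β₂ A) * ∑ i, |D.gA A z i| := by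
  obtain ⟨hβ₁, hβ₂, hdamp⟩ := hβ A hA
  obtain ⟨hB, hpsd₁, hpsd₂⟩ := hdamp z hz
  have hκ₁ := hD.κ₁_pos
  have hκ₂ := hD.κ₂_pos
  have hquad : 0 ≤ D.gA A z ⬝ᵥ ((D.B A z)⁻¹ *ᵥ D.gA A z) :=
    (mul_nonneg (by positivity) (dotProduct_self_nonneg_real _)).trans
      (mul_dotProduct_self_le_dotProduct_inv_mulVec hB hpsd₁ (D.gA A z))
  have hG := mul_nonneg hκ₂.le (dotProduct_self_nonneg_real (D.G A z *ᵥ D.grad z))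
  have hcross : D.dA A ⬝ᵥ ((D.B A z)⁻¹ *ᵥ D.gA A z) ≤
      √(1 / 2 * β₁ A * (D.dA A ⬝ᵥ D.dA A) / β₂ A) * ∑ i, |D.gA A z i| := by
    rw [Matrix.dotProduct_mulVec]
    refine (dotProduct_le_sqrt_mul_sum_abs _ _).trans ?_
    gcongr
    rw [le_div_iff₀' hβ₂]
    exact mul_dotProduct_self_vecMul_inv_le hB hpsd₂ (D.dA A)
  have hv : D.AA A z *ᵥ D.grad z = D.gA A z - D.dA A := by simp [gA]
  rw [fderiv_f_h, hv, sub_dotProduct, mul_assoc]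
  linarith [mul_le_mul_of_nonneg_left hcross hκ₁.le, mul_nonneg hκ₁.le hquad]

theorem exists_fderiv_f_h_le (hD : D.Admissible) (hβ : D.DampingBound β₁ β₂) :
    ∃ C, 0 ≤ C ∧ ∀ A ∈ D.S, ∀ z ∈ D.Gineq, A ⊆ D.act z →
      fderiv ℝ D.f z (D.h A z) ≤ C * ∑ i, |D.geq z i| := by
  have hκ₁ := hD.κ₁_pos
  let c : Finset (Fin p) → ℝ := fun A => D.κ₁ * √(1 / 2 * β₁ A * (D.dA A ⬝ᵥ D.dA A) / β₂ A)
  have hc : ∀ A, 0 ≤ c A := fun A => by positivity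
  refine ⟨∑ A ∈ D.S, c A, Finset.sum_nonneg fun A _ => hc A, fun A hA z hz hact => ?_⟩
  have hgA : ∑ i, |D.gA A z i| = ∑ i, |D.geq z i| := by
    simp [gA_eq, Fintype.sum_sum_type, fun i : {i // i ∈ A} => mem_act.1 (hact i.2)]
  calc fderiv ℝ D.f z (D.h A z) ≤ c A * ∑ i, |D.geq z i| :=
        hgA ▸ hβ.fderiv_f_h_le_mul_sum_abs_gA hD hA hz
    _ ≤ (∑ A ∈ D.S, c A) * ∑ i, |D.geq z i| := by
        gcongr
        exact Finset.single_le_sum (fun A _ => hc A) hA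

end DampingBound

end OptData

theorem eventually_lt_of_eventually_hasDerivAt_neg {g g' : ℝ → ℝ} {t : ℝ}
    (hg : ContinuousWithinAt g (Ici t) t)
    (hg' : ∀ᶠ s in 𝓝[>] t, HasDerivAt g (g' s) s ∧ g' s < 0) : ∀ᶠ s in 𝓝[>] t, g s < g t := by
  obtain ⟨u, hu, hsub⟩ := mem_nhdsGT_iff_exists_Ioo_subset.1 hg'
  have hcont : ContinuousOn g (Ico t u) := fun s hs => by
    rcases hs.1.eq_or_lt with rfl | hts
    · exact hg.mono Ico_subset_Ici_self
    · exact (hsub ⟨hts, hs.2⟩).1.continuousAt.continuousWithinAt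
  have hanti : StrictAntiOn g (Ico t u) := by
    refine strictAntiOn_of_hasDerivWithinAt_neg (f' := g') (convex_Ico t u) hcont ?_ ?_
      <;> rw [interior_Ico] <;> intro s hs
    · exact (hsub hs).1.hasDerivWithinAt
    · exact (hsub hs).2
  filter_upwards [Ioo_mem_nhdsGT hu] with s hs
  exact hanti (left_mem_Ico.2 hu) (Ioo_subset_Ico_self hs) hs.1

namespace OptData

variable {n m p : ℕ} {D : OptData n m p} {A : Finset (Fin p)} {z : EuclideanSpace ℝ (Fin n)}

theorem Admissible.eventually_gineq_neg (hD : D.Admissible) (hz : z ∈ D.Gineq) :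
    ∀ᶠ y in 𝓝 z, ∀ i ∉ D.act z, D.gineq y i < 0 :=
  eventually_all.2 fun i => eventually_imp_distrib_left.2 fun hi =>
    (hD.continuous_gineq i).continuousAt.eventually_lt_const (gineq_neg_of_notMem_act hz hi)

namespace WellPosed

theorem metricallyRegularAt_gineq (hD : D.WellPosed) (hz : z ∈ D.Gineq) :
    MetricallyRegularAt (fun y (i : {i // i ∈ D.act z}) => D.gineq y i) z := by
  refine .of_hasStrictFDerivAt
    (hasStrictFDerivAt_pi.2 fun i => hD.hasStrictFDerivAt_gineq i.1)
    (LinearMap.range_eq_top.2 fun u => ?_)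
  have hB := hD.isUnit_B (mem_S_of_subset_act (Finset.Subset.refl (D.act z))) hz
  have hJA := JA_mulVec_AA_transpose_mulVec_inv hB (Sum.elim 0 u)
  rw [JA_mulVec] at hJA
  refine ⟨WithLp.toLp 2 ((D.AA (D.act z) z)ᵀ *ᵥ ((D.B (D.act z) z)⁻¹ *ᵥ Sum.elim 0 u)), ?_⟩
  funext i
  exact (fderiv_gineq_apply _).trans (congrFun hJA (Sum.inr i))

-- The target `min (gineq y) 0` is feasible and differs from `gineq y` exactly by the violation.
theorem exists_mem_Gineq_dist_le (hD : D.WellPosed) (hz : z ∈ D.Gineq) :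
    ∃ C, 0 ≤ C ∧ ∀ s ∈ 𝓝 z, ∀ᶠ y in 𝓝 z, ∃ w ∈ D.Gineq, w ∈ s ∧
      dist w y ≤ C * ‖fun i : {i // i ∈ D.act z} => max (D.gineq y i) 0‖ := by
  obtain ⟨C, hC, hreg⟩ := hD.metricallyRegularAt_gineq hz
  refine ⟨C, hC, fun s hs => ?_⟩
  let target : EuclideanSpace ℝ (Fin n) → {i // i ∈ D.act z} → ℝ := fun y i => min (D.gineq y i) 0
  have htarget : Tendsto (fun y => (y, target y)) (𝓝 z)
      (𝓝 (z, fun i : {i // i ∈ D.act z} => D.gineq z i)) := by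
    rw [show (fun i : {i // i ∈ D.act z} => D.gineq z i) = target z from
      funext fun i => (min_eq_left (hz i)).symm]
    refine tendsto_id.prodMk_nhds (tendsto_pi_nhds.2 fun i => ?_)
    exact ((hD.continuous_gineq i.1).min continuous_const).tendsto z
  have hsolve := htarget.eventually (hreg _ (inter_mem hs (hD.eventually_gineq_neg hz)))
  filter_upwards [hsolve] with y ⟨w, ⟨hws, hwneg⟩, hw, hdist⟩
  refine ⟨w, fun i => ?_, hws, hdist.trans_eq ?_⟩
  · by_cases hi : i ∈ D.act z
    · exact (congrFun hw ⟨i, hi⟩).trans_le (min_le_right _ _)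
    · exact (hwneg i hi).le
  · rw [dist_eq_norm]
    congr 2
    funext i
    exact sub_eq_iff_eq_add'.2 ((min_add_max _ _).trans (add_zero _)).symm

theorem exists_abs_residual_le (hD : D.WellPosed) (hz : z ∈ D.Gineq) (hA : A ∈ D.S) :
    ∃ C, 0 ≤ C ∧ ∀ᶠ y in 𝓝 z, ∀ i ∈ A,
      |D.residual A y i| ≤ C * ‖fun i : {i // i ∈ D.act z} => max (D.gineq y i) 0‖ := by
  obtain ⟨K, V, hV, hK⟩ : LocallyLipschitzAt (D.residual A) z :=
    .pi (hD.locallyLipschitzAt_residual hA)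
  obtain ⟨C, hC, hdist⟩ := hD.exists_mem_Gineq_dist_le hz
  refine ⟨K * C, by positivity, ?_⟩
  filter_upwards [hV, hdist V hV] with y hy ⟨w, hwG, hwV, hwy⟩ i hi
  calc |D.residual A y i| = dist (D.residual A w i) (D.residual A y i) := by
        rw [hD.residual_eq_zero hA hwG hi, dist_comm, Real.dist_eq, sub_zero]
    _ ≤ dist (D.residual A w) (D.residual A y) := dist_le_pi_dist _ _ i
    _ ≤ K * dist w y := hK.dist_le_mul w hwV y hy
    _ ≤ K * (C * _) := by gcongr
    _ = K * C * _ := (mul_assoc _ _ _).symm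

theorem exists_norm_rate_le (hD : D.WellPosed) (hz : z ∈ D.Gineq) (hA : A ⊆ D.act z) :
    ∃ K, ∀ᶠ y in 𝓝 z, (∀ i ∈ D.act z \ A, D.gineq y i ≤ 0) →
      ‖fun i : {i // i ∈ A} => D.rate i A y‖ ≤ K * ‖fun i : {i // i ∈ A} => D.gineq y i‖ := by
  have hAS := mem_S_of_subset_act hA
  have hκ₁ := hD.κ₁_pos
  have hκ₂ := hD.κ₂_pos
  obtain ⟨C, hC, hres⟩ := hD.exists_abs_residual_le hz hAS
  refine ⟨D.κ₁ + D.κ₂ * C, ?_⟩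
  filter_upwards [hres, hD.eventually_isUnit_B (hD.isUnit_B hAS hz)] with y hy hB hout
  set g : {i // i ∈ A} → ℝ := fun i => D.gineq y i
  have hviol : ‖fun i : {i // i ∈ D.act z} => max (D.gineq y i) 0‖ ≤ ‖g‖ := by
    refine (pi_norm_le_iff_of_nonneg (norm_nonneg _)).2 fun i => ?_
    rw [Real.norm_of_nonneg (le_max_right _ _)]
    refine max_le ?_ (norm_nonneg _)
    by_cases hi : i.1 ∈ A
    · exact (le_abs_self _).trans (norm_le_pi_norm g ⟨i.1, hi⟩)
    · exact (hout i.1 (Finset.mem_sdiff.2 ⟨i.2, hi⟩)).trans (norm_nonneg _)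
  refine (pi_norm_le_iff_of_nonneg (by positivity)).2 fun i => ?_
  calc ‖D.rate i A y‖ = |-(D.κ₁ * D.gineq y i) - D.κ₂ * D.residual A y i| := by
        rw [rate_of_mem hB i.2, Real.norm_eq_abs]
    _ ≤ D.κ₁ * |D.gineq y i| + D.κ₂ * |D.residual A y i| := by
        refine (abs_sub _ _).trans_eq ?_
        rw [abs_neg, abs_mul, abs_mul, abs_of_pos hκ₁, abs_of_pos hκ₂]
    _ ≤ D.κ₁ * ‖g‖ + D.κ₂ * (C * ‖g‖) := by
        gcongr
        · exact norm_le_pi_norm g i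
        · exact (hy i i.2).trans (by gcongr)
    _ = (D.κ₁ + D.κ₂ * C) * ‖g‖ := by ring

variable {t : ℝ} {y : ℝ → EuclideanSpace ℝ (Fin n)}

theorem eventually_gineq_neg_of_rate_neg (hD : D.WellPosed)
    (hy : IsIntegralCurveAfter y (D.h A) t) {i : Fin p} (hi : D.gineq (y t) i ≤ 0)
    (hrate : ∀ᶠ s in 𝓝[>] t, D.rate i A (y s) < 0) : ∀ᶠ s in 𝓝[>] t, D.gineq (y s) i < 0 := by
  have hlt := eventually_lt_of_eventually_hasDerivAt_neg (g := fun s => D.gineq (y s) i)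
    (g' := fun s => D.rate i A (y s))
    ((hD.continuous_gineq i).continuousAt.comp_continuousWithinAt hy.continuousWithinAt) <| by
      filter_upwards [hy.eventually_hasDerivAt, hrate] with s hs hneg
      exact ⟨(hD.gineq_diff i (y s)).hasFDerivAt.comp_hasDerivAt s hs, hneg⟩
  exact hlt.mono fun s hs => hs.trans_le hi

theorem eventually_gineq_eq_zero (hD : D.WellPosed) (hy : IsIntegralCurveAfter y (D.h A) t)
    (hz : y t ∈ D.Gineq) (hA : A ⊆ D.act (y t))
    (hout : ∀ᶠ s in 𝓝[≥] t, ∀ i ∈ D.act (y t) \ A, D.gineq (y s) i ≤ 0) :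
    ∀ᶠ s in 𝓝[≥] t, ∀ i ∈ A, D.gineq (y s) i = 0 := by
  obtain ⟨K, hK⟩ := hD.exists_norm_rate_le hz hA
  obtain ⟨c, hc, hP, hcont, hderiv⟩ := hy.exists_Icc (hout.and (hy.eventually hK))
  have hzero : ∀ s ∈ Icc t c, (fun i : {i // i ∈ A} => D.gineq (y s) i) = 0 :=
    eq_zero_of_abs_deriv_le_mul_abs_self_of_eq_zero_right (K := K)
      (f' := fun s (i : {i // i ∈ A}) => D.rate i A (y s))
      (continuousOn_pi.2 fun i => (hD.continuous_gineq i).comp_continuousOn hcont)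
      (fun s hs => hasDerivWithinAt_pi.2 fun i =>
        (hD.gineq_diff i (y s)).hasFDerivAt.comp_hasDerivWithinAt s (hderiv s hs))
      (funext fun i => mem_act.1 (hA i.2))
      (fun s hs => (hP s (Ico_subset_Icc_self hs)).2 (hP s (Ico_subset_Icc_self hs)).1)
  exact mem_of_superset (Icc_mem_nhdsGE hc) fun s hs i hi => congrFun (hzero s hs) ⟨i, hi⟩

theorem eventually_feasible (hD : D.WellPosed) (hy : IsIntegralCurveAfter y (D.h A) t)
    (hz : y t ∈ D.Gineq) (hA : A ⊆ D.act (y t))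
    (hrate : ∀ i ∈ D.act (y t) \ A, ∀ᶠ s in 𝓝[>] t, D.rate i A (y s) < 0) :
    ∀ᶠ s in 𝓝[>] t, y s ∈ D.Gineq ∧ D.act (y s) = A := by
  have hleave : ∀ᶠ s in 𝓝[>] t, ∀ i ∈ D.act (y t) \ A, D.gineq (y s) i < 0 :=
    (eventually_all_finset _).2 fun i hi =>
      hD.eventually_gineq_neg_of_rate_neg hy (hz i) (hrate i hi)
  have hout : ∀ᶠ s in 𝓝[≥] t, ∀ i ∈ D.act (y t) \ A, D.gineq (y s) i ≤ 0 := by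
    rw [← Ioi_insert, nhdsWithin_insert, eventually_sup]
    exact ⟨fun i _ => hz i, hleave.mono fun s hs i hi => (hs i hi).le⟩
  have hIoi : 𝓝[>] t ≤ 𝓝[≥] t := nhdsWithin_mono t Ioi_subset_Ici_self
  filter_upwards [hleave, (hD.eventually_gineq_eq_zero hy hz hA hout).filter_mono hIoi,
    (hy.eventually (hD.eventually_gineq_neg hz)).filter_mono hIoi] with s hleave hzero hinactive
  have hneg : ∀ i ∉ A, D.gineq (y s) i < 0 := fun i hi => by
    by_cases hact : i ∈ D.act (y t)
    · exact hleave i (Finset.mem_sdiff.2 ⟨hact, hi⟩)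
    · exact hinactive i hact
  refine ⟨fun i => ?_, Finset.ext fun i => ?_⟩
  · by_cases hi : i ∈ A
    · exact (hzero i hi).le
    · exact (hneg i hi).le
  · rw [mem_act]
    exact ⟨fun h => by_contra fun hi => (hneg i hi).ne h, hzero i⟩

end WellPosed

end OptData

namespace OptData

variable {n m p : ℕ} {D : OptData n m p} {A : Finset (Fin p)} {z : EuclideanSpace ℝ (Fin n)}
  {i : Fin p} {t : ℝ} {q q' q₁ q₂ : Finset (Fin p) × ℝ}

theorem mem_addAfter : i ∈ D.addAfter t z A ↔
    i ∈ D.act z \ A ∧ D.FreqAfter t z A fun _ y => 0 ≤ D.rate i A y := by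
  simp [addAfter]

theorem addNow_subset : D.addNow z A ⊆ D.act z := fun i hi => by
  simp only [addNow, Finset.mem_filter, Finset.mem_sdiff] at hi
  exact hi.2.1.1

theorem addAfter_subset : D.addAfter t z A ⊆ D.act z :=
  fun _ hi => (Finset.mem_sdiff.1 (mem_addAfter.1 hi).1).1

theorem RemovalDue.add_δT_le (h : D.RemovalDue t z q i) : q.2 + D.δT ≤ t := by
  obtain ⟨-, ε, y, -, -, -, hfreq⟩ := h
  by_contra! hlt
  obtain ⟨s, hs, hs'⟩ := (hfreq.and_eventually (Ioo_mem_nhdsGT hlt)).exists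
  exact hs.2.not_gt hs'.2

namespace Update

theorem right_unique (h₁ : D.Update t z q q₁) (h₂ : D.Update t z q q₂) : q₁ = q₂ := by
  rcases h₁ with ⟨h₁, rfl⟩ | ⟨h₁, i, hi, hi_min, rfl⟩ <;>
    rcases h₂ with ⟨h₂, rfl⟩ | ⟨h₂, j, hj, hj_min, rfl⟩
  · rfl
  · simp [h₂] at h₁
  · simp [h₁] at h₂
  · rw [le_antisymm (not_lt.1 fun hji => hi_min j hji hj) (not_lt.1 fun hij => hj_min i hij hi)]

theorem subset_act (h : D.Update t z q q') (hq : q.1 ⊆ D.act z) : q'.1 ⊆ D.act z := by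
  rcases h with ⟨-, rfl⟩ | ⟨-, i, -, -, rfl⟩
  · exact Finset.union_subset hq addAfter_subset
  · exact (Finset.erase_subset _ _).trans hq

theorem mono_or_removal (h : D.Update t z q q') :
    (q'.2 = q.2 ∧ q.1 ⊆ q'.1) ∨ (q'.2 = t ∧ q.2 + D.δT ≤ t) := by
  rcases h with ⟨-, rfl⟩ | ⟨-, i, hi, -, rfl⟩
  · exact .inl ⟨rfl, Finset.subset_union_left⟩
  · exact .inr ⟨rfl, hi.add_δT_le⟩

end Update

/-- Termination measure of the update loop: additions enlarge the active set, and a removal closes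
the window in which removals are possible. -/
noncomputable def updateRank (D : OptData n m p) (t : ℝ) (q : Finset (Fin p) × ℝ) : ℕ ×ₗ ℕ :=
  toLex (if q.2 + D.δT ≤ t then 1 else 0, q.1ᶜ.card)

theorem Update.updateRank_lt (hδ : 0 < D.δT) (h : D.Update t z q q') :
    D.updateRank t q' < D.updateRank t q := by
  rw [updateRank, updateRank, Prod.Lex.toLex_lt_toLex]
  rcases h with ⟨⟨i, hi⟩, rfl⟩ | ⟨-, i, hi, -, rfl⟩
  · have hmem := (Finset.mem_sdiff.1 (mem_addAfter.1 hi).1).2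
    refine .inr ⟨rfl, Finset.card_lt_card (Finset.compl_ssubset_compl.2 ?_)⟩
    exact (Finset.ssubset_iff_of_subset Finset.subset_union_left).2
      ⟨i, Finset.mem_union_right _ hi, hmem⟩
  · simp [hi.add_δT_le, hδ]

theorem wellFounded_flip_update (hδ : 0 < D.δT) (t : ℝ) (z : EuclideanSpace ℝ (Fin n)) :
    WellFounded (flip (D.Update t z)) :=
  Subrelation.wf (fun h => Update.updateRank_lt hδ h) (InvImage.wf (D.updateRank t) wellFounded_lt)

/-- No update of the mode `q` is triggered at time `t` in the state `z`. -/
def Settled (D : OptData n m p) (t : ℝ) (z : EuclideanSpace ℝ (Fin n))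
    (q : Finset (Fin p) × ℝ) : Prop :=
  ∀ q', ¬ D.Update t z q q'

namespace Settled

theorem addAfter_eq_empty (h : D.Settled t z q) : D.addAfter t z q.1 = ∅ := by
  by_contra hne
  exact h _ (.inl ⟨Finset.nonempty_iff_ne_empty.2 hne, rfl⟩)

theorem not_removalDue (h : D.Settled t z q) (i : Fin p) : ¬ D.RemovalDue t z q i := fun hi => by
  obtain ⟨j, hj, hmin⟩ := WellFounded.has_min (wellFounded_lt (α := Fin p))
    {i | D.RemovalDue t z q i} ⟨i, hi⟩
  exact h _ (.inr ⟨h.addAfter_eq_empty, j, hj, fun k hk hk' => hmin k hk' hk, rfl⟩)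

end Settled

theorem exists_switch (hδ : 0 < D.δT) (t : ℝ) (z : EuclideanSpace ℝ (Fin n))
    (q : Finset (Fin p) × ℝ) : ∃ q', D.Switch t z q q' := by
  obtain ⟨q', hq', hmin⟩ := (wellFounded_flip_update hδ t z).has_min
    {q' | Relation.ReflTransGen (D.Update t z) (q.1 ∪ D.addNow z q.1, q.2) q'} ⟨_, .refl⟩
  exact ⟨q', hq', fun q'' h => hmin q'' (hq'.tail h) h⟩

namespace Switch

theorem settled (h : D.Switch t z q q') : D.Settled t z q' := h.2

theorem right_unique (h₁ : D.Switch t z q q₁) (h₂ : D.Switch t z q q₂) : q₁ = q₂ := by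
  have hterminal {a b : Finset (Fin p) × ℝ} (ha : D.Settled t z a)
      (hab : Relation.ReflTransGen (D.Update t z) a b) : a = b :=
    hab.cases_head.resolve_right fun ⟨c, hc, _⟩ => ha c hc
  have hunique : Relator.RightUnique (D.Update t z) := fun _ _ _ h h' => h.right_unique h'
  rcases Relation.ReflTransGen.total_of_right_unique hunique h₁.1 h₂.1 with h | h
  · exact hterminal h₁.settled h
  · exact (hterminal h₂.settled h).symm

theorem subset_act (h : D.Switch t z q q') (hq : q.1 ⊆ D.act z) : q'.1 ⊆ D.act z := by
  obtain ⟨hpath, -⟩ := h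
  induction hpath with
  | refl => exact Finset.union_subset hq addNow_subset
  | tail _ hupdate ih => exact hupdate.subset_act ih

theorem mono_or_removal (h : D.Switch t z q q') :
    (q'.2 = q.2 ∧ q.1 ⊆ q'.1) ∨ (q'.2 = t ∧ q.2 + D.δT ≤ t) := by
  obtain ⟨hpath, -⟩ := h
  induction hpath with
  | refl => exact .inl ⟨rfl, Finset.subset_union_left⟩
  | tail _ hupdate ih =>
    rcases ih with ⟨ih_time, ih_sub⟩ | ⟨ih_time, ih_due⟩ <;>
      rcases hupdate.mono_or_removal with ⟨htime, hsub⟩ | ⟨htime, hdue⟩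
    · exact .inl ⟨htime.trans ih_time, ih_sub.trans hsub⟩
    · exact .inr ⟨htime, ih_time ▸ hdue⟩
    · exact .inr ⟨htime.trans ih_time, ih_due⟩
    · exact .inr ⟨htime, ih_due⟩

end Switch

variable {y : ℝ → EuclideanSpace ℝ (Fin n)}

theorem freqAfter_iff_frequently {P : ℝ → EuclideanSpace ℝ (Fin n) → Prop}
    (hv : LocallyLipschitzAt (D.h A) (y t)) (hy : IsIntegralCurveAfter y (D.h A) t) :
    D.FreqAfter t (y t) A P ↔ ∃ᶠ s in 𝓝[>] t, P s (y s) := by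
  constructor
  · rintro ⟨ε, x, hε, hxt, hx, hfreq⟩
    have heq : y =ᶠ[𝓝[≥] t] x := hy.eventuallyEq ⟨t + ε, by linarith, hx⟩ hv hxt.symm
    exact (hfreq.and_eventually (heq.filter_mono (nhdsWithin_mono t Ioi_subset_Ici_self))).mono
      fun s ⟨hs, hsx⟩ => hsx ▸ hs
  · intro hfreq
    obtain ⟨b, hb, hyb⟩ := hy
    exact ⟨b - t, y, sub_pos.2 hb, rfl, by rwa [add_sub_cancel], hfreq⟩

namespace WellPosed

theorem eventually_feasible_of_settled (hD : D.WellPosed)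
    (hy : IsIntegralCurveAfter y (D.h q.1) t) (hz : y t ∈ D.Gineq) (hq : q.1 ⊆ D.act (y t))
    (hsettled : D.Settled t (y t) q) : ∀ᶠ s in 𝓝[>] t, y s ∈ D.Gineq ∧ D.act (y s) = q.1 := by
  refine hD.eventually_feasible hy hz hq fun i hi => ?_
  have hi' : i ∉ D.addAfter t (y t) q.1 := by simp [hsettled.addAfter_eq_empty]
  have hv := hD.locallyLipschitzAt_h (mem_S_of_subset_act hq) hz
  simpa only [mem_addAfter, hi, true_and, freqAfter_iff_frequently hv hy, not_frequently, not_le]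
    using hi'

theorem settled_of_act_eq (hD : D.WellPosed) (hy : IsIntegralCurveAfter y (D.h q.1) t)
    (hz : y t ∈ D.Gineq) (hact : D.act (y t) = q.1)
    (hstay : ∀ i ∈ q.1, ∀ᶠ s in 𝓝[>] t, ¬ (D.rate i (q.1.erase i) (y s) < 0 ∧ q.2 + D.δT < s)) :
    D.Settled t (y t) q := by
  have hv := hD.locallyLipschitzAt_h (mem_S_of_subset_act hact.ge) hz
  rintro q' (⟨⟨i, hi⟩, -⟩ | ⟨-, i, ⟨hi, hfreq⟩, -⟩)
  · simpa [hact] using (mem_addAfter.1 hi).1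
  · exact (freqAfter_iff_frequently hv hy).1 hfreq (hstay i hi)

theorem eventually_switch_self (hD : D.WellPosed) (hy : IsIntegralCurveAfter y (D.h q.1) t)
    (hz : y t ∈ D.Gineq) (hq : q.1 ⊆ D.act (y t)) (hsettled : D.Settled t (y t) q) :
    ∀ᶠ s in 𝓝[>] t, D.Switch s (y s) q q := by
  have hv := hD.locallyLipschitzAt_h (mem_S_of_subset_act hq) hz
  have hstay : ∀ᶠ s in 𝓝[>] t, ∀ i ∈ q.1,
      ¬ (D.rate i (q.1.erase i) (y s) < 0 ∧ q.2 + D.δT < s) :=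
    (eventually_all_finset q.1).2 fun i hi => not_frequently.1 fun hfreq =>
      hsettled.not_removalDue i ⟨hi, (freqAfter_iff_frequently hv hy).2 hfreq⟩
  filter_upwards [hD.eventually_feasible_of_settled hy hz hq hsettled,
    eventually_eventually_nhdsWithin.2 hstay, hy.eventually_isIntegralCurveAfter,
    self_mem_nhdsWithin] with s ⟨hsG, hact⟩ hstay hs hts
  rw [isOpen_Ioi.nhdsWithin_eq hts] at hstay
  have hnow : D.addNow (y s) q.1 = ∅ := by simp [addNow, hact]
  refine ⟨by rw [hnow, Finset.union_empty], hD.settled_of_act_eq hs hsG hact fun i hi => ?_⟩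
  filter_upwards [nhdsWithin_le_nhds hstay] with r hr using hr i hi

end WellPosed

end OptData

section IntegralIncrement

variable {E : Type*} [NormedAddCommGroup E] [NormedSpace ℝ E]

/-- The integral form of `z' = u` between the times `a` and `b`. Integrability of `u` is part of
the notion, since the integral of a non-integrable function is `0`. -/
def HasIntegralIncrement (u z : ℝ → E) (a b : ℝ) : Prop :=
  IntervalIntegrable u volume a b ∧ z b = z a + ∫ τ in a..b, u τ

namespace HasIntegralIncrement

variable {u u' z z' : ℝ → E} {a b c : ℝ}

theorem refl : HasIntegralIncrement u z a a := ⟨.refl, by simp⟩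

theorem symm (h : HasIntegralIncrement u z a b) : HasIntegralIncrement u z b a :=
  ⟨h.1.symm, by rw [h.2, intervalIntegral.integral_symm, neg_add_cancel_right]⟩

theorem trans (h₁ : HasIntegralIncrement u z a b) (h₂ : HasIntegralIncrement u z b c) :
    HasIntegralIncrement u z a c :=
  ⟨h₁.1.trans h₂.1,
    by rw [h₂.2, h₁.2, add_assoc, intervalIntegral.integral_add_adjacent_intervals h₁.1 h₂.1]⟩

theorem congr (h : HasIntegralIncrement u z a b) (hu : EqOn u u' (uIoo a b)) (ha : z a = z' a)
    (hb : z b = z' b) : HasIntegralIncrement u' z' a b :=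
  ⟨h.1.congr_uIoo hu, by rw [← ha, ← hb, h.2, intervalIntegral.integral_congr_uIoo hu]⟩

theorem continuousOn (h : ∀ t ∈ Icc a b, HasIntegralIncrement u z a t) :
    ContinuousOn z (Icc a b) := by
  rcases le_or_gt a b with hab | hab
  · have hc := intervalIntegral.continuousOn_primitive_interval'
      (h b (right_mem_Icc.2 hab)).1 left_mem_uIcc
    rw [uIcc_of_le hab] at hc
    exact (continuousOn_const.add hc).congr fun t ht => (h t ht).2
  · simp [Icc_eq_empty hab.not_ge]

theorem lipschitzOnWith {C : NNReal} (h : ∀ t ∈ Icc a b, HasIntegralIncrement u z a t)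
    (hC : ∀ t ∈ Icc a b, ‖u t‖ ≤ C) : LipschitzOnWith C z (Icc a b) := by
  refine LipschitzOnWith.of_dist_le_mul fun s hs t ht => ?_
  have hst := (h t ht).symm.trans (h s hs)
  rw [dist_eq_norm, hst.2, add_sub_cancel_left, Real.dist_eq]
  refine intervalIntegral.norm_integral_le_of_norm_le_const fun τ hτ => hC τ ?_
  exact uIoc_subset_uIcc.trans (ordConnected_Icc.uIcc_subset ht hs) hτ

end HasIntegralIncrement

theorem isIntegralCurveAfter_iff_hasIntegralIncrement [CompleteSpace E] {γ : ℝ → E} {v : E → E}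
    {t : ℝ} (hv : ∀ᶠ x in 𝓝 (γ t), ContinuousAt v x) :
    IsIntegralCurveAfter γ v t ↔
      ∃ b > t, ∀ s ∈ Icc t b, HasIntegralIncrement (fun τ => v (γ τ)) γ t s := by
  refine ⟨fun h => ?_, fun ⟨b, hb, h⟩ => .of_integral_eq hb (HasIntegralIncrement.continuousOn h) hv
    fun s hs => (h s hs).2⟩
  obtain ⟨b, hb, hvb, hcont, hderiv⟩ := h.exists_Icc (h.eventually hv)
  refine ⟨b, hb, fun s hs => ?_⟩
  have hsub : Icc t s ⊆ Icc t b := Icc_subset_Icc_right hs.2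
  have hint : IntervalIntegrable (fun τ => v (γ τ)) volume t s :=
    ContinuousOn.intervalIntegrable_of_Icc hs.1 fun r hr =>
      (hvb r (hsub hr)).comp_continuousWithinAt ((hcont r (hsub hr)).mono hsub)
  refine ⟨hint, ?_⟩
  rw [intervalIntegral.integral_eq_sub_of_hasDeriv_right_of_le hs.1 (hcont.mono hsub)
    (fun r hr => (hderiv r ⟨hr.1.le, hr.2.trans_le hs.2⟩).mono Ioi_subset_Ici_self) hint,
    add_sub_cancel]

end IntegralIncrement

section Gronwall

theorem eq_exp_mul_of_hasDerivWithinAt_right {g : ℝ → ℝ} {a b k : ℝ}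
    (hg : ContinuousOn g (Icc a b))
    (hd : ∀ t ∈ Ico a b, HasDerivWithinAt g (-(k * g t)) (Ici t) t) :
    ∀ t ∈ Icc a b, g t = Real.exp (-(k * (t - a))) * g a := by
  intro t ht
  have hconst := constant_of_has_deriv_right_zero (f := fun t => Real.exp (k * (t - a)) * g t)
    ((Continuous.continuousOn (by fun_prop)).mul hg) (fun r hr => ?_) t ht
  · simp only [sub_self, mul_zero, Real.exp_zero, one_mul] at hconst
    rw [← hconst, ← mul_assoc, ← Real.exp_add, neg_add_cancel, Real.exp_zero, one_mul]
  · have hexp : HasDerivWithinAt (fun t => Real.exp (k * (t - a)))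
        (Real.exp (k * (r - a)) * k) (Ici r) r := by
      simpa using ((((hasDerivAt_id r).sub_const a).const_mul k).exp).hasDerivWithinAt
    exact (hexp.mul (hd r hr)).congr_deriv (by ring)

theorem le_add_div_of_hasDerivWithinAt_right_le_exp {g g' : ℝ → ℝ} {a b k c : ℝ} (hk : 0 < k)
    (hc : 0 ≤ c) (hg : ContinuousOn g (Icc a b))
    (hd : ∀ t ∈ Ico a b, HasDerivWithinAt g (g' t) (Ici t) t)
    (hle : ∀ t ∈ Ico a b, g' t ≤ c * Real.exp (-(k * (t - a)))) :
    ∀ t ∈ Icc a b, g t ≤ g a + c / k := by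
  intro t ht
  have hbound := image_le_of_deriv_right_le_deriv_boundary
    (B := fun t => g a + c / k * (1 - Real.exp (-(k * (t - a)))))
    (B' := fun t => c * Real.exp (-(k * (t - a)))) hg hd (by simp)
    (Continuous.continuousOn (by fun_prop)) (fun r _ => ?_) hle ht
  · refine hbound.trans ?_
    have hexp := Real.exp_pos (-(k * (t - a)))
    have : 0 ≤ c / k := by positivity
    nlinarith
  · have hexp : HasDerivAt (fun t => Real.exp (-(k * (t - a))))
        (Real.exp (-(k * (r - a))) * -k) r := by
      simpa using ((((hasDerivAt_id r).sub_const a).const_mul k).neg).exp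
    refine HasDerivAt.hasDerivWithinAt ?_
    convert ((hexp.const_sub 1).const_mul (c / k)).const_add (g a) using 1
    field_simp

end Gronwall

namespace OptData

variable {n m p : ℕ} {D : OptData n m p} {z z' : ℝ → EuclideanSpace ℝ (Fin n)}
  {q q' : ℝ → Finset (Fin p) × ℝ} {L : EReal} {R s t : ℝ}

theorem horizon_mono (ht : t ∈ horizon L) (hs : 0 ≤ s) (hst : s ≤ t) : s ∈ horizon L :=
  ⟨hs, (EReal.coe_le_coe_iff.2 hst).trans_lt ht.2⟩

variable (D) in
/-- `(z, q)` is a solution of the switched system on the closed interval `[0, R]`. No switch takes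
place at the time `R` itself, so the mode `q R` is the one that is active just before `R`. -/
structure IsSolutionUntil (R : ℝ) (z : ℝ → EuclideanSpace ℝ (Fin n))
    (q : ℝ → Finset (Fin p) × ℝ) : Prop where
  init : (q 0).1 = D.act (z 0)
  increment : ∀ t ∈ Icc 0 R, HasIntegralIncrement (fun τ => D.h (q τ).1 (z τ)) z 0 t
  left_const : ∀ t ∈ Ioc 0 R, ∀ᶠ s in 𝓝[<] t, q s = q t
  switch : ∀ t ∈ Ico 0 R, ∃ q', D.Switch t (z t) (q t) q' ∧ ∀ᶠ s in 𝓝[>] t, q s = q'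

theorem IsSolution.isSolutionUntil (h : D.IsSolution L z q) (hR : R ∈ horizon L) :
    D.IsSolutionUntil R z q where
  init := h.init
  increment t ht :=
    have htL := horizon_mono hR ht.1 ht.2
    ⟨h.integrable t htL, h.integral_eq t htL⟩
  left_const t ht := h.left_const t (horizon_mono hR ht.1.le ht.2) ht.1
  switch t ht := h.switch t (horizon_mono hR ht.1 ht.2.le)

theorem IsSolution.of_forall_isSolutionUntil (h : ∀ t ∈ Ici 0, D.IsSolutionUntil t z q) :
    D.IsSolution ⊤ z q where
  init := (h 0 self_mem_Ici).init
  integrable t ht := ((h t ht.1).increment t (right_mem_Icc.2 ht.1)).1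
  integral_eq t ht := ((h t ht.1).increment t (right_mem_Icc.2 ht.1)).2
  left_const t ht ht₀ := (h t ht.1).left_const t (right_mem_Ioc.2 ht₀)
  switch t ht := (h (t + 1) (add_nonneg ht.1 zero_le_one)).switch t ⟨ht.1, lt_add_one t⟩

namespace IsSolutionUntil

theorem mono (h : D.IsSolutionUntil R z q) (htR : t ≤ R) : D.IsSolutionUntil t z q where
  init := h.init
  increment s hs := h.increment s (Icc_subset_Icc_right htR hs)
  left_const s hs := h.left_const s (Ioc_subset_Ioc_right htR hs)
  switch s hs := h.switch s (Ico_subset_Ico_right htR hs)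

theorem congr (hR : 0 ≤ R) (h : D.IsSolutionUntil R z q) (hz : EqOn z z' (Icc 0 R))
    (hq : EqOn q q' (Icc 0 R)) : D.IsSolutionUntil R z' q' where
  init := by
    have h0 := left_mem_Icc.2 hR
    rw [← hz h0, ← hq h0, h.init]
  increment t ht := by
    refine (h.increment t ht).congr (fun τ hτ => ?_) (hz (left_mem_Icc.2 hR)) (hz ht)
    have hτR : τ ∈ Icc 0 R := by
      rw [uIoo_of_le ht.1] at hτ
      exact ⟨hτ.1.le, hτ.2.le.trans ht.2⟩
    simp only [hz hτR, hq hτR]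
  left_const t ht := by
    filter_upwards [h.left_const t ht, Ioo_mem_nhdsLT ht.1] with s hs hst
    rw [← hq ⟨hst.1.le, hst.2.le.trans ht.2⟩, ← hq (Ioc_subset_Icc_self ht), hs]
  switch t ht := by
    obtain ⟨q₁, hsw, hq₁⟩ := h.switch t ht
    refine ⟨q₁, hz (Ico_subset_Icc_self ht) ▸ hq (Ico_subset_Icc_self ht) ▸ hsw, ?_⟩
    filter_upwards [hq₁, Ioo_mem_nhdsGT ht.2] with s hs hst
    rw [← hq ⟨ht.1.trans hst.1.le, hst.2.le⟩, hs]

theorem increment_of_mem (h : D.IsSolutionUntil R z q) (hs : s ∈ Icc 0 R) (ht : t ∈ Icc 0 R) :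
    HasIntegralIncrement (fun τ => D.h (q τ).1 (z τ)) z s t :=
  (h.increment s hs).symm.trans (h.increment t ht)

theorem continuousOn (h : D.IsSolutionUntil R z q) : ContinuousOn z (Icc 0 R) :=
  HasIntegralIncrement.continuousOn h.increment

theorem exists_isIntegralCurveAfter (h : D.IsSolutionUntil R z q) (hD : D.WellPosed)
    (ht : t ∈ Ico 0 R) (hz : z t ∈ D.Gineq) (hq : (q t).1 ⊆ D.act (z t)) :
    ∃ q', D.Switch t (z t) (q t) q' ∧ q'.1 ⊆ D.act (z t) ∧
      IsIntegralCurveAfter z (D.h q'.1) t ∧ ∀ᶠ s in 𝓝[>] t, q s = q' := by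
  obtain ⟨q', hsw, hq'⟩ := h.switch t ht
  have hact := hsw.subset_act hq
  refine ⟨q', hsw, hact, ?_, hq'⟩
  obtain ⟨b, hb, hsub⟩ := mem_nhdsGT_iff_exists_Ioo_subset.1 hq'
  have hcont : ∀ᶠ x in 𝓝 (z t), ContinuousAt (D.h q'.1) x :=
    (hD.eventually_locallyLipschitzAt_h (mem_S_of_subset_act hact) hz).mono
      fun _ hx => hx.continuousAt
  refine (isIntegralCurveAfter_iff_hasIntegralIncrement hcont).2
    ⟨min b R, lt_min hb ht.2, fun s hs => ?_⟩
  refine (h.increment_of_mem (Ico_subset_Icc_self ht)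
    ⟨ht.1.trans hs.1, hs.2.trans (min_le_right _ _)⟩).congr (fun τ hτ => ?_) rfl rfl
  rw [uIoo_of_le hs.1] at hτ
  have hqτ : q τ = q' := hsub ⟨hτ.1, hτ.2.trans_le (hs.2.trans (min_le_left _ _))⟩
  simp only [hqτ]

theorem feasible (h : D.IsSolutionUntil R z q) (hD : D.WellPosed) (h0 : z 0 ∈ D.Gineq) :
    ∀ t ∈ Icc 0 R, z t ∈ D.Gineq ∧ (q t).1 ⊆ D.act (z t) := by
  refine forall_mem_Icc_of_interval_induction ⟨h0, h.init.subset⟩ (fun t ht hlt => ?_)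
    fun t ht hle => ?_
  · have hlim : Tendsto z (𝓝[<] t) (𝓝 (z t)) :=
      (h.continuousOn t (Ioc_subset_Icc_self ht)).mono_of_mem_nhdsWithin <|
        mem_of_superset (Ioo_mem_nhdsLT ht.1) fun s hs => ⟨hs.1.le, hs.2.le.trans ht.2⟩
    have hmem : ∀ᶠ s in 𝓝[<] t, s ∈ Ico 0 t := Ico_mem_nhdsLT ht.1
    refine ⟨hD.isClosed_Gineq.mem_of_tendsto hlim (hmem.mono fun s hs => (hlt s hs).1),
      fun i hi => mem_act.2 ?_⟩
    refine tendsto_nhds_unique (((hD.continuous_gineq i).tendsto _).comp hlim)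
      (tendsto_const_nhds.congr' ?_)
    filter_upwards [hmem, h.left_const t ht] with s hs hqs
    exact (mem_act.1 ((hlt s hs).2 (hqs ▸ hi))).symm
  · obtain ⟨hz, hq⟩ := hle t (right_mem_Icc.2 ht.1)
    obtain ⟨q', hsw, hact, hcurve, hq'⟩ := h.exists_isIntegralCurveAfter hD ht hz hq
    filter_upwards [hD.eventually_feasible_of_settled hcurve hz hact hsw.settled, hq']
      with s hs hqs
    exact ⟨hs.1, by rw [hqs, hs.2]⟩

theorem exists_modes (h : D.IsSolutionUntil R z q) (hD : D.WellPosed) (h0 : z 0 ∈ D.Gineq) :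
    ∃ M : ℝ → Finset (Fin p), ∀ t ∈ Ico 0 R, M t ⊆ D.act (z t) ∧ z t ∈ D.Gineq ∧
      HasDerivWithinAt z (D.h (M t) (z t)) (Ici t) t := by
  have hM : ∀ t ∈ Ico 0 R, ∃ A ⊆ D.act (z t), z t ∈ D.Gineq ∧
      HasDerivWithinAt z (D.h A (z t)) (Ici t) t := fun t ht => by
    obtain ⟨hz, hq⟩ := h.feasible hD h0 t (Ico_subset_Icc_self ht)
    obtain ⟨q', -, hact, hcurve, -⟩ := h.exists_isIntegralCurveAfter hD ht hz hq
    exact ⟨q'.1, hact, hz, hcurve.eventually_hasDerivWithinAt.self_of_nhdsWithin self_mem_Ici⟩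
  choose! M hM using hM
  exact ⟨M, hM⟩

theorem geq_eq (h : D.IsSolutionUntil R z q) (hD : D.WellPosed) (h0 : z 0 ∈ D.Gineq)
    (i : Fin m) : ∀ t ∈ Icc 0 R, D.geq (z t) i = Real.exp (-(D.κ₁ * t)) * D.geq (z 0) i := by
  obtain ⟨M, hM⟩ := h.exists_modes hD h0
  suffices hdecay : ∀ t ∈ Icc 0 R,
      D.geq (z t) i = Real.exp (-(D.κ₁ * (t - 0))) * D.geq (z 0) i by simpa using hdecay
  refine eq_exp_mul_of_hasDerivWithinAt_right
    ((hD.geq_diff i).continuous.comp_continuousOn h.continuousOn) fun t ht => ?_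
  obtain ⟨hact, hz, hd⟩ := hM t ht
  rw [← hD.fderiv_geq_h (mem_S_of_subset_act hact) hz i]
  exact (hD.geq_diff i (z t)).hasFDerivAt.comp_hasDerivWithinAt t hd

end IsSolutionUntil

variable {β₁ β₂ φ : Finset (Fin p) → ℝ}

theorem Admissible.positivelyInvariant_sublevel (hD : D.Admissible) (hβ : D.DampingBound β₁ β₂)
    (hφ : D.StackBound φ) {c : ℝ} (hc : D.Fset β₁ β₂ φ ⊆ D.sublevel c) :
    D.PositivelyInvariant (D.sublevel c) := by
  intro L z q hsol h0 s hs t ht hst hzs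
  have h := hsol.isSolutionUntil ht
  obtain ⟨M, hM⟩ := h.exists_modes (hβ.wellPosed hD) h0
  have hsub : Ico s t ⊆ Ico 0 t := Ico_subset_Ico_left hs.1
  change D.f (z t) ≤ c
  refine le_of_forall_pos_le_add fun δ hδ => ?_
  refine image_le_of_deriv_right_lt_deriv_boundary' (f := fun t => D.f (z t))
    (B := fun _ => c + δ) (B' := fun _ => 0)
    (hD.f_diff.continuous.comp_continuousOn (h.continuousOn.mono (Icc_subset_Icc_left hs.1)))
    (fun r hr => (hD.f_diff (z r)).hasFDerivAt.comp_hasDerivWithinAt r (hM r (hsub hr)).2.2)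
    (le_add_of_le_of_nonneg (show D.f (z s) ≤ c from hzs) hδ.le) continuousOn_const
    (fun r _ => hasDerivWithinAt_const _ _ _) (fun r hr hfr => ?_) (right_mem_Icc.2 hst)
  obtain ⟨hact, hz, -⟩ := hM r (hsub hr)
  refine hβ.fderiv_f_h_neg hD hφ (mem_S_of_subset_act hact) hz fun hF => ?_
  have hfc : D.f (z r) ≤ c := hc hF
  linarith

theorem Admissible.exists_isSmallestSublevel (hD : D.Admissible)
    (z₀ : EuclideanSpace ℝ (Fin n)) :
    ∃ c, D.IsSmallestSublevel (D.sublevel c) (D.Fset β₁ β₂ φ ∪ {z₀}) := by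
  obtain ⟨w, hw, hmax⟩ := ((hD.isCompact_Fset β₁ β₂ φ).union
    isCompact_singleton).exists_isMaxOn ⟨z₀, Or.inr rfl⟩ hD.f_diff.continuous.continuousOn
  refine ⟨D.f w, ⟨_, rfl⟩, fun x hx => hmax hx, fun c hc x hx => (?_ : D.f x ≤ c)⟩
  exact le_trans hx (hc hw)

theorem DampingBound.exists_isCompact (hβ : D.DampingBound β₁ β₂) (hD : D.Admissible)
    {z₀ : EuclideanSpace ℝ (Fin n)} (hz₀ : z₀ ∈ D.Gineq) :
    ∃ K, IsCompact K ∧ K ⊆ D.Gineq ∧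
      ∀ R z q, D.IsSolutionUntil R z q → z 0 = z₀ → ∀ t ∈ Icc 0 R, z t ∈ K := by
  obtain ⟨C, hC, hle⟩ := DampingBound.exists_fderiv_f_h_le hD hβ
  have hD' := hβ.wellPosed hD
  let Γ := ∑ i, |D.geq z₀ i|
  have hΓ : 0 ≤ Γ := Finset.sum_nonneg fun _ _ => abs_nonneg _
  refine ⟨D.sublevel (D.f z₀ + C * Γ / D.κ₁) ∩ D.Gineq,
    (hD.isCompact_sublevel _).inter_right hD.isClosed_Gineq, inter_subset_right, ?_⟩
  rintro R z q h rfl t ht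
  obtain ⟨M, hM⟩ := h.exists_modes hD' hz₀
  refine ⟨?_, (h.feasible hD' hz₀ t ht).1⟩
  refine le_add_div_of_hasDerivWithinAt_right_le_exp (g := fun t => D.f (z t)) hD.κ₁_pos
    (mul_nonneg hC hΓ) (hD.f_diff.continuous.comp_continuousOn h.continuousOn)
    (fun r hr => (hD.f_diff (z r)).hasFDerivAt.comp_hasDerivWithinAt r (hM r hr).2.2)
    (fun r hr => ?_) t ht
  obtain ⟨hact, hz, -⟩ := hM r hr
  have hgeq : ∑ i, |D.geq (z r) i| = Real.exp (-(D.κ₁ * (r - 0))) * Γ := by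
    simp only [h.geq_eq hD' hz₀ _ r (Ico_subset_Icc_self hr), abs_mul, Real.abs_exp,
      ← Finset.mul_sum, sub_zero, Γ]
  calc fderiv ℝ D.f (z r) (D.h (M r) (z r)) ≤ C * ∑ i, |D.geq (z r) i| :=
        hle _ (mem_S_of_subset_act hact) _ hz hact
    _ = C * Γ * Real.exp (-(D.κ₁ * (r - 0))) := by rw [hgeq]; ring

theorem WellPosed.exists_norm_h_le (hD : D.WellPosed) {K : Set (EuclideanSpace ℝ (Fin n))}
    (hK : IsCompact K) (hsub : K ⊆ D.Gineq) :
    ∃ C : NNReal, ∀ A ∈ D.S, ∀ z ∈ K, ‖D.h A z‖ ≤ C := by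
  have hbound : ∀ A ∈ D.S, ∃ C, ∀ z ∈ K, ‖D.h A z‖ ≤ C := fun A hA =>
    hK.exists_bound_of_continuousOn fun z hz =>
      (hD.locallyLipschitzAt_h hA (hsub hz)).continuousAt.continuousWithinAt
  choose! C hC using hbound
  refine ⟨D.S.sup (Real.toNNReal ∘ C), fun A hA z hz => (hC A hA z hz).trans ?_⟩
  exact Real.toNNReal_le_iff_le_coe.1 (Finset.le_sup (f := Real.toNNReal ∘ C) hA)

end OptData

theorem intervalIntegrable_of_forall_Ico_of_norm_le {E : Type*} [NormedAddCommGroup E]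
    {u : ℝ → E} {a b C : ℝ} (hab : a < b) (hu : ∀ t ∈ Ico a b, IntervalIntegrable u volume a t)
    (hC : ∀ t ∈ Ico a b, ‖u t‖ ≤ C) : IntervalIntegrable u volume a b := by
  obtain ⟨x, -, hx, hlim⟩ := exists_seq_strictMono_tendsto' hab
  have hC₀ : 0 ≤ C := (norm_nonneg _).trans (hC a (left_mem_Ico.2 hab))
  refine (intervalIntegrable_iff_integrableOn_Ioc_of_le hab.le).2 <|
    integrableOn_Ioc_of_intervalIntegral_norm_bounded_right (I := C * (b - a))
      (fun k => (hu (x k) (Ioo_subset_Ico_self (hx k))).1) hlim (Eventually.of_forall fun k => ?_)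
  have hnorm := intervalIntegral.norm_integral_le_of_norm_le_const (f := fun τ => ‖u τ‖)
    (a := a) (b := x k) (C := C) fun τ hτ => by
      rw [uIoc_of_le (hx k).1.le] at hτ
      rw [norm_norm]
      exact hC τ ⟨hτ.1.le, hτ.2.trans_lt (hx k).2⟩
  rw [← intervalIntegral.integral_of_le (hx k).1.le]
  calc ∫ τ in a..x k, ‖u τ‖ ≤ C * |x k - a| := (le_abs_self _).trans hnorm
    _ ≤ C * (b - a) := by
      rw [abs_of_pos (sub_pos.2 (hx k).1)]
      gcongr
      exact (hx k).2.le

theorem exists_forall_ge_eq_of_monotoneOn {α β : Type*} [Preorder α] [PartialOrder β]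
    [WellFoundedGT β] {f : α → β} {s : Set α} (hf : MonotoneOn f s) (hs : s.Nonempty) :
    ∃ c ∈ s, ∀ t ∈ s, c ≤ t → f t = f c := by
  obtain ⟨_, ⟨c, hc, rfl⟩, hmax⟩ := wellFounded_gt.has_min (f '' s) (hs.image f)
  exact ⟨c, hc, fun t ht hct =>
    (eq_of_le_of_not_lt (hf hc ht hct) (hmax _ (mem_image_of_mem f ht))).symm⟩

namespace OptData

variable {n m p : ℕ} {D : OptData n m p} {z z' : ℝ → EuclideanSpace ℝ (Fin n)}
  {q q' : ℝ → Finset (Fin p) × ℝ} {β₁ β₂ : Finset (Fin p) → ℝ} {R s t b : ℝ}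

namespace IsSolutionUntil

section DwellTime

theorem mode_induction (h : D.IsSolutionUntil R z q) {P : Finset (Fin p) × ℝ → Prop}
    (hs : 0 ≤ s) (hst : s ≤ t) (htR : t ≤ R) (base : P (q s))
    (step : ∀ r ∈ Ico s t, ∀ q', P (q r) → D.Switch r (z r) (q r) q' → P q') : P (q t) := by
  refine forall_mem_Icc_of_interval_induction (P := fun r => P (q r)) base (fun r hr hlt => ?_)
    (fun r hr hle => ?_) t (right_mem_Icc.2 hst)
  · obtain ⟨r', hqr, hr'⟩ := ((h.left_const r ⟨hs.trans_lt hr.1, hr.2.trans htR⟩).and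
      (Ico_mem_nhdsLT hr.1)).exists
    exact hqr ▸ hlt r' hr'
  · obtain ⟨q', hsw, hq'⟩ := h.switch r ⟨hs.trans hr.1, hr.2.trans_le htR⟩
    have hP := step r hr q' (hle r (right_mem_Icc.2 hr.1)) hsw
    filter_upwards [hq'] with r' hr'
    rwa [hr']

theorem mono_of_le_add_δT (h : D.IsSolutionUntil R z q) (hs : 0 ≤ s) (hst : s ≤ t) (htR : t ≤ R)
    (hdwell : t ≤ (q s).2 + D.δT) : (q t).2 = (q s).2 ∧ (q s).1 ⊆ (q t).1 := by
  refine h.mode_induction (P := fun q' => q'.2 = (q s).2 ∧ (q s).1 ⊆ q'.1) hs hst htR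
    ⟨rfl, subset_rfl⟩ fun r hr q' ⟨htime, hsub⟩ hsw => ?_
  rcases hsw.mono_or_removal with ⟨htime', hsub'⟩ | ⟨-, hdue⟩
  · exact ⟨htime'.trans htime, hsub.trans hsub'⟩
  · rw [htime] at hdue
    linarith [hr.2]

theorem mono_or_le_removal (h : D.IsSolutionUntil R z q) (hs : 0 ≤ s) (hst : s ≤ t)
    (htR : t ≤ R) : ((q t).2 = (q s).2 ∧ (q s).1 ⊆ (q t).1) ∨ s ≤ (q t).2 := by
  refine h.mode_induction
    (P := fun q' => (q'.2 = (q s).2 ∧ (q s).1 ⊆ q'.1) ∨ s ≤ q'.2) hs hst htR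
    (.inl ⟨rfl, subset_rfl⟩) fun r hr q' hqr hsw => ?_
  rcases hsw.mono_or_removal with ⟨htime, hsub⟩ | ⟨htime, -⟩
  · rw [htime]
    exact hqr.imp_left fun ⟨htime', hsub'⟩ => ⟨htime', hsub'.trans hsub⟩
  · exact .inr (htime ▸ hr.1)

theorem exists_mono (hδ : 0 < D.δT) (hR : 0 < R) (h : ∀ t ∈ Ico 0 R, D.IsSolutionUntil t z q) :
    ∃ b ∈ Ico 0 R, ∀ s ∈ Ico b R, ∀ t ∈ Ico s R, (q t).2 = (q s).2 ∧ (q s).1 ⊆ (q t).1 := by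
  by_cases hlast : ∃ b ∈ Ico 0 R, R ≤ (q b).2 + D.δT
  · obtain ⟨b, hb, hbR⟩ := hlast
    refine ⟨b, hb, fun s hs t ht => ?_⟩
    have hs₀ : 0 ≤ s := hb.1.trans hs.1
    have htime := ((h s ⟨hs₀, hs.2⟩).mono_of_le_add_δT hb.1 hs.1 le_rfl (hs.2.le.trans hbR)).1
    exact (h t ⟨hs₀.trans ht.1, ht.2⟩).mono_of_le_add_δT hs₀ ht.1 le_rfl
      (htime ▸ ht.2.le.trans hbR)
  · push Not at hlast
    refine ⟨max 0 (R - D.δT), ⟨le_max_left _ _, max_lt hR (by linarith)⟩, fun s hs t ht => ?_⟩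
    have hs₀ : 0 ≤ s := (le_max_left _ _).trans hs.1
    have ht₀ : t ∈ Ico 0 R := ⟨hs₀.trans ht.1, ht.2⟩
    refine ((h t ht₀).mono_or_le_removal hs₀ ht.1 le_rfl).resolve_right fun hle => ?_
    linarith [hlast t ht₀, (le_max_right 0 (R - D.δT)).trans hs.1]

theorem exists_mode_const (hδ : 0 < D.δT) (hR : 0 < R)
    (h : ∀ t ∈ Ico 0 R, D.IsSolutionUntil t z q) :
    ∃ c ∈ Ico 0 R, ∀ t ∈ Ico c R, q t = q c := by
  obtain ⟨b, hb, hmono⟩ := exists_mono hδ hR h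
  obtain ⟨c, hc, hconst⟩ := exists_forall_ge_eq_of_monotoneOn (f := fun t => (q t).1)
    (fun s hs t ht hst => (hmono s hs t ⟨hst, ht.2⟩).2) ⟨b, left_mem_Ico.2 hb.2⟩
  exact ⟨c, ⟨hb.1.trans hc.1, hc.2⟩, fun t ht =>
    Prod.ext (hconst t ⟨hc.1.trans ht.1, ht.2⟩ ht.1) (hmono c hc t ht).1⟩

end DwellTime

section Continuation

theorem of_forall_lt (hR : 0 < R) (h : ∀ t ∈ Ico 0 R, D.IsSolutionUntil t z q)
    (hinc : HasIntegralIncrement (fun τ => D.h (q τ).1 (z τ)) z 0 R)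
    (hleft : ∀ᶠ s in 𝓝[<] R, q s = q R) : D.IsSolutionUntil R z q where
  init := (h 0 (left_mem_Ico.2 hR)).init
  increment t ht := by
    rcases ht.2.eq_or_lt with rfl | htR
    · exact hinc
    · exact (h t ⟨ht.1, htR⟩).increment t (right_mem_Icc.2 ht.1)
  left_const t ht := by
    rcases ht.2.eq_or_lt with rfl | htR
    · exact hleft
    · exact (h t ⟨ht.1.le, htR⟩).left_const t (right_mem_Ioc.2 ht.1)
  switch t ht := by
    obtain ⟨b, htb, hbR⟩ := exists_between ht.2
    exact (h b ⟨ht.1.trans htb.le, hbR⟩).switch t ⟨ht.1, htb⟩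

theorem intervalIntegrable_of_forall_lt (hD : D.Admissible) (hβ : D.DampingBound β₁ β₂)
    (hR : 0 < R) (h : ∀ t ∈ Ico 0 R, D.IsSolutionUntil t z q) (h0 : z 0 ∈ D.Gineq) :
    IntervalIntegrable (fun τ => D.h (q τ).1 (z τ)) volume 0 R := by
  obtain ⟨K, hK, hKG, hzK⟩ := hβ.exists_isCompact hD h0
  obtain ⟨C, hC⟩ := (hβ.wellPosed hD).exists_norm_h_le hK hKG
  refine intervalIntegrable_of_forall_Ico_of_norm_le (C := C) hR
    (fun t ht => ((h t ht).increment t (right_mem_Icc.2 ht.1)).1) fun t ht => ?_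
  have htt : t ∈ Icc 0 t := right_mem_Icc.2 ht.1
  have hmem := mem_S_of_subset_act ((h t ht).feasible (hβ.wellPosed hD) h0 t htt).2
  exact hC _ hmem _ (hzK t z q (h t ht) rfl t htt)

theorem exists_extension_to_endpoint (hD : D.Admissible) (hβ : D.DampingBound β₁ β₂) (hR : 0 < R)
    (h : ∀ t ∈ Ico 0 R, D.IsSolutionUntil t z q) (h0 : z 0 ∈ D.Gineq) :
    ∃ z' q', D.IsSolutionUntil R z' q' ∧ z' 0 = z 0 ∧ q' 0 = q 0 := by
  let u : ℝ → EuclideanSpace ℝ (Fin n) := fun τ => D.h (q τ).1 (z τ)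
  obtain ⟨c, hc, hconst⟩ := exists_mode_const hD.δT_pos hR h
  let z' := Function.update z R (z 0 + ∫ τ in (0 : ℝ)..R, u τ)
  let q' := Function.update q R (q c)
  have hz' : EqOn z z' (Ico 0 R) := fun t ht => (Function.update_of_ne ht.2.ne _ _).symm
  have hq' : EqOn q q' (Ico 0 R) := fun t ht => (Function.update_of_ne ht.2.ne _ _).symm
  have hqR : q' R = q c := Function.update_self ..
  have hzR : z' R = z 0 + ∫ τ in (0 : ℝ)..R, u τ := Function.update_self ..
  have h0R : (0 : ℝ) ∈ Ico 0 R := left_mem_Ico.2 hR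
  have hinc : HasIntegralIncrement u z' 0 R :=
    ⟨intervalIntegrable_of_forall_lt hD hβ hR h h0, hz' h0R ▸ hzR⟩
  refine ⟨z', q', of_forall_lt hR (fun t ht => ?_) (hinc.congr (fun τ hτ => ?_) rfl rfl) ?_,
    (hz' h0R).symm, (hq' h0R).symm⟩
  · have hsub : Icc 0 t ⊆ Ico 0 R := Icc_subset_Ico_right ht.2
    exact (h t ht).congr ht.1 (hz'.mono hsub) (hq'.mono hsub)
  · rw [uIoo_of_le hR.le] at hτ
    simp only [u, hz' (Ioo_subset_Ico_self hτ), hq' (Ioo_subset_Ico_self hτ)]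
  · filter_upwards [Ico_mem_nhdsLT hc.2] with s hs
    rw [← hq' ⟨hc.1.trans hs.1, hs.2⟩, hconst s hs, hqR]

theorem append (hR : 0 ≤ R) (h : D.IsSolutionUntil R z q) {q₁ : Finset (Fin p) × ℝ}
    (hRq : D.Switch R (z R) (q R) q₁) (hq : ∀ t ∈ Ioc R b, q t = q₁)
    (hinc : ∀ t ∈ Icc R b, HasIntegralIncrement (fun τ => D.h q₁.1 (z τ)) z R t)
    (hsw : ∀ t ∈ Ioc R b, D.Switch t (z t) q₁ q₁) : D.IsSolutionUntil b z q where
  init := h.init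
  increment t ht := by
    rcases le_or_gt t R with htR | htR
    · exact h.increment t ⟨ht.1, htR⟩
    · refine (h.increment R (right_mem_Icc.2 hR)).trans
        ((hinc t ⟨htR.le, ht.2⟩).congr (fun τ hτ => ?_) rfl rfl)
      rw [uIoo_of_le htR.le] at hτ
      simp only [hq τ ⟨hτ.1, hτ.2.le.trans ht.2⟩]
  left_const t ht := by
    rcases le_or_gt t R with htR | htR
    · exact h.left_const t ⟨ht.1, htR⟩
    · filter_upwards [Ioo_mem_nhdsLT htR] with s hs
      rw [hq s ⟨hs.1, hs.2.le.trans ht.2⟩, hq t ⟨htR, ht.2⟩]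
  switch t ht := by
    rcases lt_or_ge t R with htR | htR
    · exact h.switch t ⟨ht.1, htR⟩
    · have hright : ∀ᶠ s in 𝓝[>] t, q s = q₁ := by
        filter_upwards [Ioo_mem_nhdsGT ht.2] with s hs using hq s ⟨htR.trans_lt hs.1, hs.2.le⟩
      rcases htR.eq_or_lt with rfl | htR
      · exact ⟨q₁, hRq, hright⟩
      · have htb : t ∈ Ioc R b := ⟨htR, ht.2.le⟩
        exact ⟨q₁, hq t htb ▸ hsw t htb, hright⟩

theorem exists_extension_beyond (hR : 0 ≤ R) (h : D.IsSolutionUntil R z q) (hD : D.WellPosed)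
    (h0 : z 0 ∈ D.Gineq) :
    ∃ b > R, ∃ z' q', D.IsSolutionUntil b z' q' ∧ z' 0 = z 0 ∧ q' 0 = q 0 := by
  obtain ⟨hz, hact⟩ := h.feasible hD h0 R (right_mem_Icc.2 hR)
  obtain ⟨q₁, hsw⟩ := exists_switch hD.δT_pos R (z R) (q R)
  have hact₁ := hsw.subset_act hact
  have hA := mem_S_of_subset_act hact₁
  obtain ⟨y, hyR, hy⟩ := IsIntegralCurveAfter.exists_of_locallyLipschitzAt
    (hD.locallyLipschitzAt_h hA hz) R
  rw [← hyR] at hz hact₁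
  obtain ⟨b₁, hb₁, hinc⟩ := (isIntegralCurveAfter_iff_hasIntegralIncrement
    ((hD.eventually_locallyLipschitzAt_h hA hz).mono fun _ hx => hx.continuousAt)).1 hy
  obtain ⟨b₂, hb₂, hstay⟩ := mem_nhdsGT_iff_exists_Ioc_subset.1
    (hD.eventually_switch_self hy hz hact₁ (hyR ▸ hsw.settled))
  let z' : ℝ → EuclideanSpace ℝ (Fin n) := (Iic R).piecewise z y
  let q' : ℝ → Finset (Fin p) × ℝ := (Iic R).piecewise q fun _ => q₁
  have hz' : EqOn z z' (Iic R) := (piecewise_eqOn _ _ _).symm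
  have hq' : EqOn q q' (Iic R) := (piecewise_eqOn _ _ _).symm
  have hy' : EqOn y z' (Ici R) := fun t ht => by
    rcases (mem_Ici.1 ht).eq_or_lt with rfl | ht
    · rw [hyR, hz' self_mem_Iic]
    · exact (piecewise_eq_of_notMem _ _ _ (notMem_Iic.2 ht)).symm
  have hq₁ : ∀ t > R, q' t = q₁ := fun t ht => piecewise_eq_of_notMem _ _ _ (notMem_Iic.2 ht)
  refine ⟨min b₁ b₂, lt_min hb₁ hb₂, z', q', append (R := R) hR ?_ ?_ (fun t ht => hq₁ t ht.1)
    (fun t ht => ?_) (fun t ht => ?_), (hz' hR).symm, (hq' hR).symm⟩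
  · exact h.congr hR (hz'.mono fun t ht => ht.2) (hq'.mono fun t ht => ht.2)
  · exact hz' self_mem_Iic ▸ hq' self_mem_Iic ▸ hsw
  · refine (hinc t ⟨ht.1, ht.2.trans (min_le_left _ _)⟩).congr (fun τ hτ => ?_)
      (hy' self_mem_Ici) (hy' ht.1)
    rw [uIoo_of_le ht.1] at hτ
    simp only [hy' (le_of_lt hτ.1)]
  · rw [← hy' ht.1.le]
    exact hstay ⟨ht.1, ht.2.trans (min_le_right _ _)⟩

end Continuation

end IsSolutionUntil

end OptData

namespace OptData

variable {n m p : ℕ} {D : OptData n m p} {z z' : ℝ → EuclideanSpace ℝ (Fin n)}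
  {q q' : ℝ → Finset (Fin p) × ℝ} {β₁ β₂ : Finset (Fin p) → ℝ} {R : ℝ}
  {z₀ : EuclideanSpace ℝ (Fin n)} {T₀ : ℝ}

theorem IsSolutionUntil.unique (h : D.IsSolutionUntil R z q) (h' : D.IsSolutionUntil R z' q')
    (hD : D.WellPosed) (h0 : z 0 ∈ D.Gineq) (hz : z 0 = z' 0) (hT : (q 0).2 = (q' 0).2) :
    ∀ t ∈ Icc 0 R, z t = z' t ∧ q t = q' t := by
  refine forall_mem_Icc_of_interval_induction
    ⟨hz, Prod.ext (by rw [h.init, h'.init, hz]) hT⟩ (fun t ht hlt => ?_) fun t ht hle => ?_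
  · have hmem : ∀ᶠ s in 𝓝[<] t, s ∈ Ico 0 t := Ico_mem_nhdsLT ht.1
    have hIcc : Icc 0 R ∈ 𝓝[<] t := mem_of_superset hmem fun s hs => ⟨hs.1, hs.2.le.trans ht.2⟩
    have hlim := (h.continuousOn t (Ioc_subset_Icc_self ht)).mono_of_mem_nhdsWithin hIcc
    have hlim' := (h'.continuousOn t (Ioc_subset_Icc_self ht)).mono_of_mem_nhdsWithin hIcc
    refine ⟨tendsto_nhds_unique (hlim.congr' (hmem.mono fun s hs => (hlt s hs).1)) hlim', ?_⟩
    obtain ⟨s, hs, hqs, hqs'⟩ := (hmem.and ((h.left_const t ht).and (h'.left_const t ht))).exists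
    rw [← hqs, ← hqs', (hlt s hs).2]
  · obtain ⟨hzt, hqt⟩ := hle t (right_mem_Icc.2 ht.1)
    obtain ⟨hG, hact⟩ := h.feasible hD h0 t (Ico_subset_Icc_self ht)
    obtain ⟨q₁, hsw, hact₁, hcurve, hq₁⟩ := h.exists_isIntegralCurveAfter hD ht hG hact
    obtain ⟨q₁', hsw', -, hcurve', hq₁'⟩ :=
      h'.exists_isIntegralCurveAfter hD ht (hzt ▸ hG) (hzt ▸ hqt ▸ hact)
    obtain rfl : q₁ = q₁' := hsw.right_unique (hzt ▸ hqt ▸ hsw')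
    have hcurves : z =ᶠ[𝓝[≥] t] z' := hcurve.eventuallyEq hcurve'
      (hD.locallyLipschitzAt_h (mem_S_of_subset_act hact₁) hG) hzt
    filter_upwards [hcurves.filter_mono (nhdsWithin_mono t Ioi_subset_Ici_self), hq₁, hq₁']
      with s hzs hqs hqs'
    exact ⟨hzs, hqs.trans hqs'.symm⟩

/-- The existence of a solution on `[0, R]` that starts from the state `z₀` with the time of last
removal `T₀`. -/
def HasSolutionUntil (D : OptData n m p) (z₀ : EuclideanSpace ℝ (Fin n)) (T₀ R : ℝ) : Prop :=
  ∃ z q, D.IsSolutionUntil R z q ∧ z 0 = z₀ ∧ (q 0).2 = T₀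

theorem exists_forall_isSolutionUntil (hD : D.WellPosed) (hz₀ : z₀ ∈ D.Gineq) {S : Set ℝ}
    (hS : S.OrdConnected) (h0 : 0 ∈ S) (hpos : S ⊆ Ici 0)
    (h : ∀ t ∈ S, D.HasSolutionUntil z₀ T₀ t) :
    ∃ z q, (∀ t ∈ S, D.IsSolutionUntil t z q) ∧ z 0 = z₀ ∧ (q 0).2 = T₀ := by
  choose! Z Q hsol hZ hQ using h
  have hagree : ∀ t ∈ S, ∀ s ∈ Icc 0 t, Z t s = Z s s ∧ Q t s = Q s s := fun t ht s hs => by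
    have hsS : s ∈ S := hS.out h0 ht hs
    exact ((hsol t ht).mono hs.2).unique (hsol s hsS) hD (hZ t ht ▸ hz₀)
      ((hZ t ht).trans (hZ s hsS).symm) ((hQ t ht).trans (hQ s hsS).symm) s (right_mem_Icc.2 hs.1)
  exact ⟨fun t => Z t t, fun t => Q t t, fun t ht => (hsol t ht).congr (hpos ht)
    (fun s hs => (hagree t ht s hs).1) fun s hs => (hagree t ht s hs).2, hZ 0 h0, hQ 0 h0⟩

theorem DampingBound.hasSolutionUntil (hβ : D.DampingBound β₁ β₂) (hD : D.Admissible)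
    (hz₀ : z₀ ∈ D.Gineq) (hR : 0 ≤ R) : D.HasSolutionUntil z₀ T₀ R := by
  refine forall_mem_Icc_of_interval_induction (P := D.HasSolutionUntil z₀ T₀) ?_
    (fun t ht hlt => ?_) (fun t ht hle => ?_) R (right_mem_Icc.2 hR)
  · refine ⟨fun _ => z₀, fun _ => (D.act z₀, T₀), ⟨rfl, fun t ht => ?_, ?_, ?_⟩, rfl, rfl⟩
    · rw [Icc_self, mem_singleton_iff] at ht
      exact ht ▸ .refl
    · simp
    · simp
  · obtain ⟨z, q, h, hz, hq⟩ := exists_forall_isSolutionUntil (hβ.wellPosed hD) hz₀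
      ordConnected_Ico (left_mem_Ico.2 ht.1) Ico_subset_Ici_self hlt
    obtain ⟨z', q', h', hz', hq'⟩ :=
      IsSolutionUntil.exists_extension_to_endpoint hD hβ ht.1 h (hz ▸ hz₀)
    exact ⟨z', q', h', hz'.trans hz, hq' ▸ hq⟩
  · obtain ⟨z, q, h, hz, hq⟩ := hle t (right_mem_Icc.2 ht.1)
    obtain ⟨b, hb, z', q', h', hz', hq'⟩ :=
      h.exists_extension_beyond ht.1 (hβ.wellPosed hD) (hz ▸ hz₀)
    filter_upwards [Ioo_mem_nhdsGT hb] with s hs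
    exact ⟨z', q', h'.mono hs.2.le, hz'.trans hz, hq' ▸ hq⟩

theorem DampingBound.exists_isSolution (hβ : D.DampingBound β₁ β₂) (hD : D.Admissible)
    (hz₀ : z₀ ∈ D.Gineq) (T₀ : ℝ) : ∃ z q, D.IsSolution ⊤ z q ∧ z 0 = z₀ ∧ (q 0).2 = T₀ := by
  obtain ⟨z, q, h, hz, hq⟩ := exists_forall_isSolutionUntil (hβ.wellPosed hD) hz₀ ordConnected_Ici
    self_mem_Ici subset_rfl fun _ => hβ.hasSolutionUntil hD hz₀
  exact ⟨z, q, .of_forall_isSolutionUntil h, hz, hq⟩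

namespace IsSolution

theorem isSolutionUntil_of_nonneg (h : D.IsSolution ⊤ z q) {t : ℝ} (ht : 0 ≤ t) :
    D.IsSolutionUntil t z q :=
  h.isSolutionUntil ⟨ht, EReal.coe_lt_top t⟩

theorem fst_mem_S (h : D.IsSolution ⊤ z q) (hD : D.WellPosed) (h0 : z 0 ∈ D.Gineq) {t : ℝ}
    (ht : 0 ≤ t) : (q t).1 ∈ D.S :=
  mem_S_of_subset_act
    ((h.isSolutionUntil_of_nonneg ht).feasible hD h0 t (right_mem_Icc.2 ht)).2

theorem isBounded_image (h : D.IsSolution ⊤ z q) (hD : D.Admissible)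
    (hβ : D.DampingBound β₁ β₂) (h0 : z 0 ∈ D.Gineq) : Bornology.IsBounded (z '' Ici 0) := by
  obtain ⟨K, hK, -, hzK⟩ := hβ.exists_isCompact hD h0
  refine hK.isBounded.subset (image_subset_iff.2 fun t ht => ?_)
  exact hzK t z q (h.isSolutionUntil_of_nonneg ht) rfl t (right_mem_Icc.2 ht)

theorem absolutelyContinuousOnInterval (h : D.IsSolution ⊤ z q) (hD : D.Admissible)
    (hβ : D.DampingBound β₁ β₂) (h0 : z 0 ∈ D.Gineq) {t : ℝ} (ht : 0 ≤ t) :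
    AbsolutelyContinuousOnInterval z 0 t := by
  obtain ⟨K, hK, hKG, hzK⟩ := hβ.exists_isCompact hD h0
  obtain ⟨C, hC⟩ := (hβ.wellPosed hD).exists_norm_h_le hK hKG
  have hlip : LipschitzOnWith C z (Icc 0 t) :=
    HasIntegralIncrement.lipschitzOnWith (h.isSolutionUntil_of_nonneg ht).increment fun s hs =>
      hC _ (h.fst_mem_S (hβ.wellPosed hD) h0 hs.1) _
        (hzK t z q (h.isSolutionUntil_of_nonneg ht) rfl s hs)
  rw [← uIcc_of_le ht] at hlip
  exact hlip.absolutelyContinuousOnInterval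

theorem unique (h : D.IsSolution ⊤ z q) (hD : D.WellPosed) {L : EReal} (h' : D.IsSolution L z' q')
    (h0 : z 0 ∈ D.Gineq) (hz : z' 0 = z 0) (hT : (q' 0).2 = (q 0).2) {t : ℝ}
    (ht : t ∈ horizon L) : z' t = z t ∧ q' t = q t :=
  (h'.isSolutionUntil ht).unique (h.isSolutionUntil_of_nonneg ht.1) hD (hz ▸ h0) hz hT t
    (right_mem_Icc.2 ht.1)

end IsSolution

end OptData

theorem proposition3 {n m p : ℕ} (D : OptData n m p) (hD : D.Admissible)
    (β₁ β₂ : Finset (Fin p) → ℝ) (hβ : D.DampingBound β₁ β₂) :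
    (∀ φ : Finset (Fin p) → ℝ, D.StackBound φ →
      (∀ c : ℝ, D.Fset β₁ β₂ φ ⊆ D.sublevel c → D.PositivelyInvariant (D.sublevel c)) ∧
      (∀ z₀ ∈ D.Gineq, ∃ F₀ : Set (EuclideanSpace ℝ (Fin n)),
        D.IsSmallestSublevel F₀ (D.Fset β₁ β₂ φ ∪ {z₀}) ∧ D.PositivelyInvariant F₀)) ∧
    (∀ z₀ ∈ D.Gineq, ∀ T₀ : ℝ,
      ∃ (z : ℝ → EuclideanSpace ℝ (Fin n)) (q : ℝ → Finset (Fin p) × ℝ),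
        D.IsSolution ⊤ z q ∧ z 0 = z₀ ∧ (q 0).2 = T₀ ∧
        (∀ t, 0 ≤ t → (q t).1 ∈ D.S) ∧
        (∀ t, 0 ≤ t → AbsolutelyContinuousOnInterval z 0 t) ∧
        Bornology.IsBounded (z '' Ici 0) ∧
        ∀ (L : EReal) (z' : ℝ → EuclideanSpace ℝ (Fin n)) (q' : ℝ → Finset (Fin p) × ℝ),
          D.IsSolution L z' q' → z' 0 = z₀ → (q' 0).2 = T₀ →
          ∀ t ∈ OptData.horizon L, z' t = z t ∧ q' t = q t) := by
  refine ⟨fun φ hφ => ⟨fun c hc => hD.positivelyInvariant_sublevel hβ hφ hc,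
    fun z₀ _ => ?_⟩, fun z₀ hz₀ T₀ => ?_⟩
  · obtain ⟨c, hc⟩ := hD.exists_isSmallestSublevel (β₁ := β₁) (β₂ := β₂) (φ := φ) z₀
    exact ⟨_, hc, hD.positivelyInvariant_sublevel hβ hφ (subset_union_left.trans hc.2.1)⟩
  · obtain ⟨z, q, hsol, rfl, rfl⟩ := hβ.exists_isSolution hD hz₀ T₀
    have hD' := hβ.wellPosed hD
    exact ⟨z, q, hsol, rfl, rfl, fun t ht => hsol.fst_mem_S hD' hz₀ ht,
      fun t ht => hsol.absolutelyContinuousOnInterval hD hβ hz₀ ht,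
      hsol.isBounded_image hD hβ hz₀,
      fun L z' q' h' hz hT t ht => hsol.unique hD' h' hz₀ hz hT ht⟩
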